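/- **Theorem (generalized Clifford wavelet uncertainty principle).** Let $n\equiv 2$ or $3 \pmod 4$ and let $Cl_n=Cl_{n,0}$ be the real Clifford algebra of Euclidean $\mathbb R^n$ with orthonormal basis $e_1,\dots,e_n$, so $x^2=|x|^2$ for $x\in\mathbb R^n$. Write $\langle M\rangle$ for the scalar part of $M\in Cl_n$, $\widetilde M$ for its reverse, $M\ast N=\langle MN\rangle$, $|M|^2=\langle M\widetilde M\rangle$, and $i_n=e_1e_2\cdots e_n$, so $i_n^2=-1$. For $F,G\in L^2(X;Cl_n)$ on a measure space $X$ put $(F,G)=\int_X F\,\widetilde G$ and $\|F\|^2=\int_X|F|^2$. The Clifford Fourier transform of $f\in L^2(\mathbb R^n;Cl_n)$ is $\hat f(\omega)=\int_{\mathbb R^n} f(x)\,e^{-i_n\,\omega\cdot x}\,d^nx$, the integral being the $L^2$-limit, as $R\to\infty$, of the integrals over the balls $|x|<R$. Let $\mathcal G=(\mathbb R^+\times SO(n))\ltimes\mathbb R^n$ be the similitude group with left Haar measure $d\lambda(a,r,b)=d\mu(a,r)\,d^nb$, $d\mu(a,r)=a^{-(n+1)}\,da\,dr$, where $dr$ is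 a Haar measure on $SO(n)$. Let $\psi\in L^2(\mathbb R^n;Cl_n)$ be an admissible wavelet, i.e. there is an invertible $C_\psi\in Cl_n$ such that for almost every $\omega\in\mathbb R^n$ the integral $$\int_{\mathbb R^+\times SO(n)} a^n\,\widetilde{\hat\psi(a r^{-1}\omega)}\;\hat\psi(a r^{-1}\omega)\,d\mu(a,r)$$ converges absolutely and equals $C_\psi$; if $n\equiv2\pmod4$, assume moreover that $\psi$ takes its values either in the even part or in the odd part of $Cl_n$. For $f\in L^2(\mathbb R^n;Cl_n)$ put $$T_\psi f(a,r,b)=\int_{\mathbb R^n} f(x)\,\widetilde{\psi_{a,r,b}(x)}\,d^nx,\qquad \psi_{a,r,b}(x)=a^{-n/2}\,\psi\bigl(r^{-1}(\tfrac{x-b}{a})\bigr).$$ Then for every $f\in L^2(\mathbb R^n;Cl_n)$ $$\bigl\|\,b\,T_\psi f(a,r,b)\bigr\|^2_{L^2(\mathcal G;Cl_n)}\;\cdot\; C_\psi\ast\bigl(\widetilde{\omega\hat f},\widetilde{\omega\hat f}\bigr)_{L^2(\mathbb R^n;Cl_n)}\;\ge\;\frac{n(2\pi)^n}{4}\,\Bigl[C_\psi\ast(\tilde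 f,\tilde f)_{L^2(\mathbb R^n;Cl_n)}\Bigr]^2 .$$ Both factors on the left are read in $[0,\infty]$, the second being $\infty$ if $\omega\hat f\notin L^2(\mathbb R^n;Cl_n)$, with $0\cdot\infty=0$. -/

import Mathlib

open MeasureTheory Filter Topology
open scoped ENNReal

noncomputable section

namespace CliffordWavelet

/-- Euclidean space `ℝⁿ`. -/
abbrev E (n : ℕ) : Type := EuclideanSpace ℝ (Fin n)

/-- The positive definite quadratic form `x ↦ ⟪x, x⟫` on `ℝⁿ`. -/
def Q (n : ℕ) : QuadraticForm ℝ (E n) := LinearMap.BilinMap.toQuadraticMap (innerₗ (E n))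

/-- The real Clifford geometric algebra `Clₙ = Cl_{n,0}`. -/
abbrev Cl (n : ℕ) : Type := CliffordAlgebra (Q n)

variable {n : ℕ}

/-- A vector of `ℝⁿ`, viewed as a multivector of grade one. -/
def vec (x : E n) : Cl n := CliffordAlgebra.ι (Q n) x

/-- The reverse `M ↦ M~`, the anti-automorphism of `Clₙ` fixing vectors. -/
def rev (M : Cl n) : Cl n := CliffordAlgebra.reverse M

/-- The scalar part `⟨M⟩₀`: the component of degree zero under the canonical linear isomorphism
of `Clₙ` with the exterior algebra of `ℝⁿ`. -/
def Sc (M : Cl n) : ℝ :=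
  letI : Invertible (2 : ℝ) := invertibleOfNonzero two_ne_zero
  ExteriorAlgebra.algebraMapInv (CliffordAlgebra.equivExterior (Q n) M)

/-- The scalar product `M ∗ N = ⟨M N⟩₀`. -/
def scalarProd (M N : Cl n) : ℝ := Sc (M * N)

/-- The squared modulus `|M|² = M ∗ M~`. -/
def modSq (M : Cl n) : ℝ := scalarProd M (rev M)

/-- The basis blade `e_A = e_{i₁} ⋯ e_{iₖ}` for `A = {i₁ < ⋯ < iₖ}`. -/
def blade (A : Finset (Fin n)) : Cl n :=
  ((A.sort (· ≤ ·)).map fun i => vec (EuclideanSpace.single i (1 : ℝ))).prod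

/-- The coefficient `M_A` in `M = ∑_A M_A e_A`; the blades are orthonormal for `M ∗ N~`. -/
def coord (A : Finset (Fin n)) (M : Cl n) : ℝ := scalarProd M (rev (blade A))

/-- The unit pseudoscalar `iₙ = e₁ e₂ ⋯ eₙ`. -/
def pseudo (n : ℕ) : Cl n := blade Finset.univ

/-- The exponential `e^{iₙ t} = cos t + iₙ sin t` (used where `iₙ² = -1`). -/
def expI (t : ℝ) : Cl n := Real.cos t • (1 : Cl n) + Real.sin t • pseudo n

section Integration

variable {X : Type*} [MeasurableSpace X]

/-- Integrability of a multivector valued function: all its blade components are integrable. -/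
def ClIntegrable (F : X → Cl n) (μ : Measure X) : Prop :=
  ∀ A : Finset (Fin n), Integrable (fun x => coord A (F x)) μ

/-- The integral `∑_A (∫ F_A dμ) e_A` of a multivector valued function. -/
def clIntegral (μ : Measure X) (F : X → Cl n) : Cl n :=
  ∑ A : Finset (Fin n), (∫ x, coord A (F x) ∂μ) • blade A

/-- `F ∈ L²(X; Clₙ)`: all blade components are square integrable. -/
def IsL2 (F : X → Cl n) (μ : Measure X) : Prop :=
  ∀ A : Finset (Fin n), MemLp (fun x => coord A (F x)) 2 μ

/-- The multivector valued inner product `(F, G) = ∫ F G~ dμ`. -/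
def innerCl (μ : Measure X) (F G : X → Cl n) : Cl n :=
  clIntegral μ fun x => F x * rev (G x)

/-- The squared norm `‖F‖² = ∫ |F|² dμ`, with values in `[0, ∞]`. -/
def normSqL2 (μ : Measure X) (F : X → Cl n) : ℝ≥0∞ :=
  ∫⁻ x, ENNReal.ofReal (modSq (F x)) ∂μ

open Classical in
/-- The quantity `C ∗ (G, G)` with values in `[0, ∞]`: it is `∞` if `G` is not in `L²`. -/
def starSelf (μ : Measure X) (C : Cl n) (G : X → Cl n) : ℝ≥0∞ :=
  if IsL2 G μ then ENNReal.ofReal (scalarProd C (innerCl μ G G)) else ⊤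

end Integration

/-- The Clifford Fourier integral `∫ f(x) e^{-iₙ ω·x} dx`. -/
def cftIntegral (f : E n → Cl n) (ω : E n) : Cl n :=
  clIntegral volume fun x => f x * expI (-(inner ℝ ω x))

/-- `F` is a Clifford Fourier transform of `f ∈ L²(ℝⁿ; Clₙ)`: the limit in `L²`, as `R → ∞`, of
the Fourier integrals of `f` over the balls of radius `R`. -/
def IsCFT (f F : E n → Cl n) : Prop :=
  IsL2 F volume ∧
    Tendsto (fun R : ℝ => normSqL2 volume fun ω =>
      F ω - cftIntegral ((Metric.ball (0 : E n) R).indicator f) ω) atTop (𝓝 0)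

/-- The Clifford Fourier transform of `f ∈ L²(ℝⁿ; Clₙ)` (determined almost everywhere). -/
def cft (f : E n → Cl n) : E n → Cl n := Classical.epsilon (IsCFT f)

/-- The rotation group `SO(n)`. -/
abbrev SO (n : ℕ) : Type := Matrix.specialOrthogonalGroup (Fin n) ℝ

instance : MeasurableSpace (SO n) := borel _

instance : BorelSpace (SO n) := ⟨rfl⟩

/-- The action of a rotation on `ℝⁿ`. -/
def rot (r : SO n) (x : E n) : E n := WithLp.toLp 2 (Matrix.mulVec r.1 x.ofLp)

/-- The measure `dμ(a, θ) = a^{-(n+1)} da dθ` on `ℝ⁺ × SO(n)`, where `dθ = ν`. The first factor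
is carried by the positive reals. -/
def dilRotMeasure (ν : Measure (SO n)) : Measure (ℝ × SO n) :=
  ((volume.restrict (Set.Ioi (0 : ℝ))).withDensity
    fun a => ENNReal.ofReal ((a ^ (n + 1))⁻¹)).prod ν

/-- The left Haar measure `dλ(a, θ, b) = dμ(a, θ) db` on the similitude group
`SIM(n) = (ℝ⁺ × SO(n)) ⋉ ℝⁿ`. -/
def simMeasure (ν : Measure (SO n)) : Measure ((ℝ × SO n) × E n) :=
  (dilRotMeasure ν).prod volume

/-- The daughter wavelet `ψ_{a,θ,b}(x) = a^{-n/2} ψ(r_θ⁻¹((x - b)/a))`. -/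
def daughter (ψ : E n → Cl n) (g : (ℝ × SO n) × E n) (x : E n) : Cl n :=
  (g.1.1 ^ ((n : ℝ) / 2))⁻¹ • ψ (rot g.1.2⁻¹ (g.1.1⁻¹ • (x - g.2)))

/-- The Clifford wavelet transform `T_ψ f(a,θ,b) = ∫ f(x) ψ_{a,θ,b}(x)~ dx`. -/
def waveletTransform (ψ f : E n → Cl n) (g : (ℝ × SO n) × E n) : Cl n :=
  innerCl volume f (daughter ψ g)

/-- The integrand `aⁿ ψ̂(a r_θ⁻¹ ω)~ ψ̂(a r_θ⁻¹ ω)` of the admissibility constant. -/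
def admIntegrand (ψ : E n → Cl n) (ω : E n) (p : ℝ × SO n) : Cl n :=
  p.1 ^ n • (rev (cft ψ (p.1 • rot p.2⁻¹ ω)) * cft ψ (p.1 • rot p.2⁻¹ ω))

/-- `ψ ∈ L²(ℝⁿ; Clₙ)` is admissible with admissibility constant `C = C_ψ`: for almost every `ω`
the integral `∫ aⁿ ψ̂(a r_θ⁻¹ ω)~ ψ̂(a r_θ⁻¹ ω) dμ(a,θ)` is finite and equal to the
invertible multivector `C`. -/
def IsAdmissible (ν : Measure (SO n)) (ψ : E n → Cl n) (C : Cl n) : Prop :=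
  IsL2 ψ volume ∧ IsUnit C ∧
    ∀ᵐ ω : E n, ClIntegrable (admIntegrand ψ ω) (dilRotMeasure ν) ∧
      clIntegral (dilRotMeasure ν) (admIntegrand ψ ω) = C

/-- `ψ` takes values (almost everywhere) in the even part or in the odd part of `Clₙ`. -/
def HasParity (ψ : E n → Cl n) : Prop :=
  (∀ᵐ x : E n, ψ x ∈ CliffordAlgebra.evenOdd (Q n) 0) ∨
    (∀ᵐ x : E n, ψ x ∈ CliffordAlgebra.evenOdd (Q n) 1)

end CliffordWavelet

end

noncomputable section

namespace CliffordWavelet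

variable {n : ℕ}

/-! Right multiplication by $i_n$ is a complex structure on $Cl_n$, because $i_n^2=-1$ when $n\equiv
2,3 \pmod 4$. The Clifford Fourier transform is therefore a finite family of ordinary ones
(`cCoord_cftI`), and it inherits Plancherel with constant $(2\pi)^n$ (`lintegral_cftI_sq`). It
commutes with every linear map that commutes with right multiplication by the exponentials
(`IsL2CFT.clm`).

Put $F=\hat f$, $\Psi=\hat\psi$, $p=(a,r)$ and
$H_p(\omega)=F(\omega)\,\bigl(a^{n/2}\Psi(ar^{-1}\omega)\bigr)^\sim$, the `waveletSymbol`.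
Plancherel gives $(2\pi)^nT_\psi f(p,b)=\int F e^{i_n\omega\cdot b}(a^{n/2}\Psi(ar^{-1}\omega))^\sim
d\omega$ (`waveletTransform_eq`). The exponential stands in the wrong place. The parity assumption
(or centrality of $i_n$ for odd $n$) gives $i_n\Psi=\varepsilon\Psi i_n$ with $\varepsilon=\pm1$, so
it moves to the right at the cost of $b\mapsto\varepsilon b$. Hence $(2\pi)^nT_\psi f(p,b)$ is the
Fourier integral of $H_p$ at $-\varepsilon b$ (`cftI_waveletSymbol`).

By admissibility $\int|H_p(\omega)|^2d\mu(p)=\langle F(\omega),F(\omega)C\rangle$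
(`lintegral_waveletSymbol`). Integrated against $1$ and $|\omega|^2$ this gives $(2\pi)^n\,C*(\tilde
f,\tilde f)$ and, if $\omega\hat f\in L^2$, $C*(\widetilde{\omega\hat f},\widetilde{\omega\hat f})$.
The first identity uses that $C$ commutes with $i_n$. The theorem is thus Heisenberg's inequality
for the family $H_p$ (`uncertainty_family`).

Heisenberg is proved without derivatives. Since $|e^{i_ns}-1|\le|s|$, finiteness of $\iint
b_k^2|\widehat{H_p}(b)|^2$ makes translation of $H$ along $e_k$ Lipschitz in $L^2$. A discrete
commutator identity for multiplication by $\omega_k$ and translation by $t$, divided by $t$ as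
$t\to0$, yields the inequality in one coordinate. -/

/-! ### Algebra of the blades -/

/-- The `i`-th basis vector as a multivector. -/
def gen (i : Fin n) : Cl n := vec (EuclideanSpace.single i (1 : ℝ))

/-- The product of the basis vectors of a list of indices. -/
def genProd (l : List (Fin n)) : Cl n := (l.map gen).prod

@[simp] lemma genProd_nil : genProd ([] : List (Fin n)) = 1 := rfl

@[simp] lemma genProd_cons (i : Fin n) (l : List (Fin n)) :
    genProd (i :: l) = gen i * genProd l := by simp [genProd]

lemma genProd_append (l l' : List (Fin n)) : genProd (l ++ l') = genProd l * genProd l' := by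
  simp [genProd]

lemma blade_eq_genProd (A : Finset (Fin n)) : blade A = genProd (A.sort (· ≤ ·)) := rfl

lemma vec_mul_self (x : E n) : vec x * vec x = (‖x‖ ^ 2) • (1 : Cl n) := by
  rw [vec, CliffordAlgebra.ι_sq_scalar, Algebra.algebraMap_eq_smul_one]
  congr 1
  simp [Q]

lemma vec_mul_vec_add_swap (x y : E n) :
    vec x * vec y + vec y * vec x = (2 * inner ℝ x y) • (1 : Cl n) := by
  rw [vec, vec, CliffordAlgebra.ι_mul_ι_add_swap, Algebra.algebraMap_eq_smul_one]
  congr 1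
  simp [QuadraticMap.polar, Q, inner_add_right, real_inner_comm x y]
  rw [real_inner_comm]; ring

lemma gen_mul_self (i : Fin n) : gen i * gen i = (1 : Cl n) := by
  simp [gen, vec_mul_self]

lemma gen_mul_gen {i j : Fin n} (h : i ≠ j) : gen i * gen j = -(gen j * gen i : Cl n) := by
  have := vec_mul_vec_add_swap (EuclideanSpace.single i (1 : ℝ)) (EuclideanSpace.single j (1 : ℝ))
  rw [EuclideanSpace.inner_single_left] at this
  simp only [PiLp.single_apply, h, if_false, mul_zero, zero_smul] at this
  exact eq_neg_of_add_eq_zero_left this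

/-- Distinct generators anticommute, so each adjacent swap costs one sign. Orthogonality of the
blades needs products only up to sign. -/
lemma genProd_perm {l l' : List (Fin n)} (h : l.Perm l') (hl : l.Nodup) :
    genProd l = genProd l' ∨ genProd l = -genProd l' := by
  induction h with
  | nil => simp
  | cons x _ ih =>
    rcases ih (List.nodup_cons.1 hl).2 with h | h <;> simp [h]
  | swap x y l =>
    have hxy : y ≠ x := by
      simp only [List.nodup_cons, List.mem_cons, not_or] at hl
      exact hl.1.1
    right
    simp only [genProd_cons, ← mul_assoc, gen_mul_gen hxy, neg_mul]
  | trans h1 _ ih1 ih2 =>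
    rcases ih1 hl with h | h <;> rcases ih2 (h1.nodup_iff.1 hl) with h' | h' <;> simp [h, h']

lemma genProd_mul_gen {i : Fin n} {l : List (Fin n)} (h : i ∉ l) :
    genProd l * gen i = (-1 : ℝ) ^ l.length • (gen i * genProd l) := by
  induction l with
  | nil => simp
  | cons x l ih =>
    simp only [List.mem_cons, not_or] at h
    rw [genProd_cons, mul_assoc, ih h.2, mul_smul_comm, ← mul_assoc, gen_mul_gen (Ne.symm h.1),
      List.length_cons, pow_succ, mul_smul]
    simp [mul_assoc]

lemma rev_mul (M N : Cl n) : rev (M * N) = rev N * rev M := CliffordAlgebra.reverse.map_mul M N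

@[simp] lemma rev_rev (M : Cl n) : rev (rev M) = M := CliffordAlgebra.reverse_reverse M

@[simp] lemma rev_vec (x : E n) : rev (vec x) = vec x := CliffordAlgebra.reverse_ι x

@[simp] lemma rev_one : rev (1 : Cl n) = 1 := CliffordAlgebra.reverse.map_one

@[simp] lemma rev_add (M N : Cl n) : rev (M + N) = rev M + rev N := map_add _ _ _

@[simp] lemma rev_neg (M : Cl n) : rev (-M) = -rev M := map_neg _ _

@[simp] lemma rev_smul (c : ℝ) (M : Cl n) : rev (c • M) = c • rev M := map_smul _ _ _

lemma rev_genProd (l : List (Fin n)) : rev (genProd l) = genProd l.reverse := by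
  induction l with
  | nil => simp
  | cons x l ih => simp [rev_mul, ih, genProd_append, gen]

lemma genProd_mul_rev (l : List (Fin n)) : genProd l * rev (genProd l) = 1 := by
  induction l with
  | nil => simp
  | cons x l ih =>
    rw [genProd_cons, rev_mul, ← mul_assoc, mul_assoc (gen x), ih, mul_one, gen, rev_vec]
    exact gen_mul_self x

lemma blade_mul_rev (A : Finset (Fin n)) : blade A * rev (blade A) = 1 := genProd_mul_rev _

lemma rev_genProd_of_nodup {l : List (Fin n)} (h : l.Nodup) :
    rev (genProd l) = (-1 : ℝ) ^ (l.length * (l.length - 1) / 2) • genProd l := by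
  induction l with
  | nil => simp
  | cons x l ih =>
    rw [List.nodup_cons] at h
    rw [genProd_cons, rev_mul, ih h.2, gen, rev_vec, ← gen, smul_mul_assoc, genProd_mul_gen h.1,
      smul_smul, ← pow_add]
    congr 2
    simp only [List.length_cons, Nat.add_sub_cancel]
    -- Moving the new generator past $k$ others costs $k$ signs, and $k(k-1)/2+k=(k+1)k/2$.
    rw [← Nat.triangle_succ, Nat.add_sub_cancel]

lemma blade_empty : blade (∅ : Finset (Fin n)) = 1 := by simp [blade]

lemma genProd_eq_blade {l : List (Fin n)} (h : l.Nodup) :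
    genProd l = blade l.toFinset ∨ genProd l = -blade l.toFinset := by
  refine genProd_perm ?_ h
  refine (List.perm_ext_iff_of_nodup h (Finset.sort_nodup _ _)).2 fun a => by simp

lemma rev_blade (A : Finset (Fin n)) : rev (blade A) = blade A ∨ rev (blade A) = -blade A := by
  rw [blade_eq_genProd, rev_genProd]
  refine genProd_perm (List.reverse_perm _) ?_
  exact List.nodup_reverse.2 (Finset.sort_nodup _ _)

lemma gen_mul_blade_of_notMem {i : Fin n} {A : Finset (Fin n)} (h : i ∉ A) :
    gen i * blade A = blade (insert i A) ∨ gen i * blade A = -blade (insert i A) := by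
  have := genProd_eq_blade (l := i :: A.sort (· ≤ ·)) (by simp [h, Finset.sort_nodup])
  simpa [← blade_eq_genProd] using this

/-- If $i\in A$, the factor $e_i$ is brought to the front and cancelled by $e_i^2=1$; otherwise it
is sorted into place. -/
lemma gen_mul_blade (i : Fin n) (A : Finset (Fin n)) :
    gen i * blade A = blade (symmDiff {i} A) ∨ gen i * blade A = -blade (symmDiff {i} A) := by
  by_cases h : i ∈ A
  · have hs : symmDiff {i} A = A.erase i := by
      ext j; simp only [Finset.mem_symmDiff, Finset.mem_singleton, Finset.mem_erase]
      constructor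
      · rintro (⟨rfl, h'⟩ | h')
        · exact absurd h h'
        · exact h'.symm
      · exact fun h' => Or.inr h'.symm
    rw [hs]
    rcases gen_mul_blade_of_notMem (Finset.notMem_erase i A) with h' | h' <;>
      rw [Finset.insert_erase h] at h'
    · left; rw [← h', ← mul_assoc, gen_mul_self, one_mul]
    · right
      rw [eq_neg_iff_add_eq_zero, ← neg_eq_iff_add_eq_zero, ← mul_neg, ← h', ← mul_assoc,
        gen_mul_self, one_mul]
  · have hs : symmDiff {i} A = insert i A := by
      ext j; simp only [Finset.mem_symmDiff, Finset.mem_singleton, Finset.mem_insert]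
      constructor
      · rintro (⟨rfl, h'⟩ | h')
        · simp
        · exact Or.inr h'.1
      · rintro (rfl | h')
        · exact Or.inl ⟨rfl, h⟩
        · exact Or.inr ⟨h', fun e => h (e ▸ h')⟩
    rw [hs]
    exact gen_mul_blade_of_notMem h

lemma genProd_mul_blade (l : List (Fin n)) (hl : l.Nodup) (B : Finset (Fin n)) :
    genProd l * blade B = blade (symmDiff l.toFinset B) ∨
      genProd l * blade B = -blade (symmDiff l.toFinset B) := by
  induction l with
  | nil => left; simp [← Finset.bot_eq_empty]
  | cons x l ih =>
    rw [List.nodup_cons] at hl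
    have hs : symmDiff (x :: l).toFinset B = symmDiff {x} (symmDiff l.toFinset B) := by
      rw [← symmDiff_assoc, List.toFinset_cons]
      congr 1
      ext j; simp only [Finset.mem_symmDiff, Finset.mem_singleton, Finset.mem_insert,
        List.mem_toFinset]
      constructor
      · rintro (rfl | h)
        · exact Or.inl ⟨rfl, hl.1⟩
        · exact Or.inr ⟨h, fun e => hl.1 (e ▸ h)⟩
      · rintro (h | h)
        · exact Or.inl h.1
        · exact Or.inr h.1
    rw [hs, genProd_cons, mul_assoc]
    rcases ih hl.2 with h | h <;> rcases gen_mul_blade x (symmDiff l.toFinset B) with h' | h' <;>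
      simp [h, h']

lemma blade_mul_blade (A B : Finset (Fin n)) :
    blade A * blade B = blade (symmDiff A B) ∨ blade A * blade B = -blade (symmDiff A B) := by
  have := genProd_mul_blade (A.sort (· ≤ ·)) (Finset.sort_nodup _ _) B
  simpa [← blade_eq_genProd] using this

/-! ### The scalar part -/

/-- The scalar part as a linear form. -/
def ScL : Cl n →ₗ[ℝ] ℝ :=
  letI : Invertible (2 : ℝ) := invertibleOfNonzero two_ne_zero
  ExteriorAlgebra.algebraMapInv.toLinearMap ∘ₗ (CliffordAlgebra.equivExterior (Q n)).toLinearMap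

lemma ScL_apply (M : Cl n) : ScL M = Sc M := rfl

@[simp] lemma Sc_add (M N : Cl n) : Sc (M + N) = Sc M + Sc N := map_add ScL M N

@[simp] lemma Sc_neg (M : Cl n) : Sc (-M) = -Sc M := map_neg ScL M

@[simp] lemma Sc_zero : Sc (0 : Cl n) = 0 := map_zero ScL

@[simp] lemma Sc_smul (c : ℝ) (M : Cl n) : Sc (c • M) = c * Sc M := map_smul ScL c M

@[simp] lemma Sc_one : Sc (1 : Cl n) = 1 := by
  let _ : Invertible (2 : ℝ) := invertibleOfNonzero two_ne_zero
  change ExteriorAlgebra.algebraMapInv (CliffordAlgebra.changeForm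
    CliffordAlgebra.changeForm.associated_neg_proof (1 : Cl n)) = 1
  rw [CliffordAlgebra.changeForm_one]
  exact map_one ExteriorAlgebra.algebraMapInv

/-- In the exterior algebra $xM$ becomes $x\wedge M+x\lrcorner M$, and a wedge product with a vector
has no scalar part. -/
lemma Sc_vec_mul (x : E n) (M : Cl n) :
    Sc (vec x * M) = Sc (CliffordAlgebra.contractLeft (innerₗ (E n) x) M) := by
  let _ : Invertible (2 : ℝ) := invertibleOfNonzero two_ne_zero
  change ExteriorAlgebra.algebraMapInv (CliffordAlgebra.changeForm
    CliffordAlgebra.changeForm.associated_neg_proof (CliffordAlgebra.ι (Q n) x * M)) =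
    ExteriorAlgebra.algebraMapInv (CliffordAlgebra.changeForm
      CliffordAlgebra.changeForm.associated_neg_proof
      (CliffordAlgebra.contractLeft (innerₗ (E n) x) M))
  rw [CliffordAlgebra.changeForm_ι_mul, CliffordAlgebra.changeForm_contractLeft, map_sub]
  -- The change of form goes from $Q$ to $0$, hence uses the bilinear form of $-Q$; its sign cancels
  -- the one in `changeForm_ι_mul`.
  have h1 : QuadraticMap.associated (R := ℝ) (-(Q n)) x = -innerₗ (E n) x := by
    ext y
    have := congrArg (fun B => B x y) (QuadraticMap.two_nsmul_associated ℝ (-(Q n)))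
    simp only [Q, LinearMap.smul_apply, QuadraticMap.polarBilin_apply_apply, innerₗ_apply_apply, _root_.neg_apply,
      LinearMap.BilinMap.toQuadraticMap_apply, QuadraticMap.polar, nsmul_eq_mul,
      inner_add_left, inner_add_right, real_inner_comm x y] at this
    rw [LinearMap.neg_apply, innerₗ_apply_apply]
    push_cast at this
    simp only [Q]
    linarith
  generalize CliffordAlgebra.changeForm _ M = y
  rw [h1, map_neg, LinearMap.neg_apply, map_neg, sub_neg_eq_add, map_mul]
  have h2 : ExteriorAlgebra.algebraMapInv
      (CliffordAlgebra.ι (0 : QuadraticForm ℝ (E n)) x : ExteriorAlgebra ℝ (E n)) = 0 := by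
    change ExteriorAlgebra.algebraMapInv (ExteriorAlgebra.ι ℝ x) = 0
    simp [ExteriorAlgebra.algebraMapInv]
  rw [h2, zero_mul, zero_add]

lemma contractLeft_genProd {i : Fin n} {l : List (Fin n)} (h : i ∉ l) :
    CliffordAlgebra.contractLeft (innerₗ (E n) (EuclideanSpace.single i (1 : ℝ))) (genProd l) =
      0 := by
  induction l with
  | nil => simp
  | cons x l ih =>
    simp only [List.mem_cons, not_or] at h
    have : innerₗ (E n) (EuclideanSpace.single i (1 : ℝ)) (EuclideanSpace.single x (1 : ℝ)) = 0 := by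
      rw [innerₗ_apply_apply, EuclideanSpace.inner_single_left]
      simp [h.1]
    rw [genProd_cons, gen, vec, CliffordAlgebra.contractLeft_ι_mul, ih h.2, this]
    simp

lemma Sc_blade {A : Finset (Fin n)} (h : A ≠ ∅) : Sc (blade A) = 0 := by
  rw [blade_eq_genProd]
  have hn := Finset.sort_nodup A (· ≤ ·)
  cases hl : A.sort (· ≤ ·) with
  | nil =>
    have := congrArg List.toFinset hl
    simp at this; exact absurd this h
  | cons x l =>
    rw [hl, List.nodup_cons] at hn
    rw [genProd_cons, gen, Sc_vec_mul, contractLeft_genProd hn.1, Sc_zero]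

lemma Sc_blade_mul_blade {A B : Finset (Fin n)} (h : A ≠ B) : Sc (blade A * blade B) = 0 := by
  have : symmDiff A B ≠ ∅ := fun e => h (symmDiff_eq_bot.1 e)
  rcases blade_mul_blade A B with h | h <;> simp [h, Sc_blade this]

lemma Sc_blade_mul_rev_blade (A B : Finset (Fin n)) :
    Sc (blade A * rev (blade B)) = if A = B then 1 else 0 := by
  split_ifs with h
  · rw [h, blade_mul_rev, Sc_one]
  · rcases rev_blade B with h' | h' <;> simp [h', Sc_blade_mul_blade h]

lemma vec_eq_sum (x : E n) : vec x = ∑ i, x i • gen i := by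
  conv_lhs => rw [← (EuclideanSpace.basisFun (Fin n) ℝ).sum_repr x]
  simp [gen, vec]

lemma span_blade : Submodule.span ℝ (Set.range (blade : Finset (Fin n) → Cl n)) = ⊤ := by
  rw [eq_top_iff]
  rintro M -
  induction M using CliffordAlgebra.left_induction with
  | algebraMap r =>
    rw [Algebra.algebraMap_eq_smul_one, ← blade_empty]
    exact Submodule.smul_mem _ _ (Submodule.subset_span ⟨_, rfl⟩)
  | add x y hx hy => exact Submodule.add_mem _ hx hy
  | ι_mul x m hx =>
    have hm : CliffordAlgebra.ι (Q n) m = ∑ i, m i • gen i := vec_eq_sum m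
    rw [hm, Finset.sum_mul]
    refine Submodule.sum_mem _ fun i _ => ?_
    rw [smul_mul_assoc]
    refine Submodule.smul_mem _ _ ?_
    induction hx using Submodule.span_induction with
    | mem x hx =>
      obtain ⟨A, rfl⟩ := hx
      rcases gen_mul_blade i A with h | h <;> rw [h]
      · exact Submodule.subset_span ⟨_, rfl⟩
      · exact Submodule.neg_mem _ (Submodule.subset_span ⟨_, rfl⟩)
    | zero => simp
    | add x y _ _ hx hy => rw [mul_add]; exact Submodule.add_mem _ hx hy
    | smul c x _ hx => rw [mul_smul_comm]; exact Submodule.smul_mem _ _ hx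

/-- Linear maps out of `Clₙ` that agree on the blades are equal. -/
lemma linearMap_ext_blade {V : Type*} [AddCommGroup V] [Module ℝ V] {S T : Cl n →ₗ[ℝ] V}
    (h : ∀ A, S (blade A) = T (blade A)) : S = T :=
  LinearMap.ext_on_range span_blade h

/-- By bilinearity it suffices to test blades, where both sides vanish unless the blades coincide.
-/
lemma Sc_mul_comm (M N : Cl n) : Sc (M * N) = Sc (N * M) := by
  have : (LinearMap.mul ℝ (Cl n)).compr₂ ScL = (LinearMap.mul ℝ (Cl n)).flip.compr₂ ScL := by
    refine linearMap_ext_blade fun A => linearMap_ext_blade fun B => ?_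
    change Sc (blade A * blade B) = Sc (blade B * blade A)
    by_cases h : A = B
    · rw [h]
    · rw [Sc_blade_mul_blade h, Sc_blade_mul_blade (Ne.symm h)]
  exact congrArg (fun T => T M N) this

lemma Sc_rev (M : Cl n) : Sc (rev M) = Sc M := by
  have : ScL ∘ₗ CliffordAlgebra.reverse = (ScL : Cl n →ₗ[ℝ] ℝ) := by
    refine linearMap_ext_blade fun A => ?_
    change Sc (rev (blade A)) = Sc (blade A)
    by_cases h : A = ∅
    · rw [h, blade_empty, rev_one]
    · rcases rev_blade A with h' | h' <;> simp [h', Sc_blade h]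
  exact congrArg (fun T => T M) this

/-! ### The pseudoscalar -/

/-- Reversion multiplies $i_n$ by $(-1)^{n(n-1)/2}$, which is $-1$ in these residue classes, while
$i_n\widetilde{i_n}=1$. -/
lemma pseudo_mul_self (hn : n % 4 = 2 ∨ n % 4 = 3) : pseudo n * pseudo n = -1 := by
  have h1 := rev_genProd_of_nodup (Finset.sort_nodup (Finset.univ : Finset (Fin n)) (· ≤ ·))
  rw [← blade_eq_genProd, Finset.length_sort, Finset.card_univ, Fintype.card_fin] at h1
  have h2 := blade_mul_rev (Finset.univ : Finset (Fin n))
  have hodd : Odd (n * (n - 1) / 2) := by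
    obtain ⟨k, hk | hk⟩ : ∃ k, n = 4 * k + 2 ∨ n = 4 * k + 3 := ⟨n / 4, by omega⟩
    · have : n * (n - 1) = 2 * (2 * (4 * k * k + 3 * k) + 1) := by
        rw [hk, show 4 * k + 2 - 1 = 4 * k + 1 by omega]; ring
      rw [this, Nat.mul_div_cancel_left _ two_pos]; exact ⟨_, rfl⟩
    · have : n * (n - 1) = 2 * (2 * (4 * k * k + 5 * k + 1) + 1) := by
        rw [hk, show 4 * k + 3 - 1 = 4 * k + 2 by omega]; ring
      rw [this, Nat.mul_div_cancel_left _ two_pos]; exact ⟨_, rfl⟩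
  rw [hodd.neg_one_pow, neg_one_smul] at h1
  rw [h1, mul_neg] at h2
  exact neg_eq_iff_eq_neg.1 h2

lemma rev_pseudo (hn : n % 4 = 2 ∨ n % 4 = 3) : rev (pseudo n) = -pseudo n := by
  have h1 := pseudo_mul_self hn
  have h2 := blade_mul_rev (Finset.univ : Finset (Fin n))
  rcases rev_blade (Finset.univ : Finset (Fin n)) with h | h
  · rw [h] at h2
    have h3 : (1 : Cl n) = -1 := h2.symm.trans h1
    have := congrArg Sc h3
    simp at this; norm_num at this
  · exact h

/-- Among the factors of $i_n$, $e_i$ anticommutes with the $n-1$ others and commutes with itself.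
-/
lemma gen_mul_pseudo (i : Fin n) : gen i * pseudo n = (-1 : ℝ) ^ (n - 1) • (pseudo n * gen i) := by
  have hi : i ∉ (Finset.univ.erase i).sort (· ≤ ·) := by simp
  have hl : ((Finset.univ.erase i : Finset (Fin n)).sort (· ≤ ·)).length = n - 1 := by simp
  have h := genProd_mul_gen hi
  rw [hl] at h
  set A := (Finset.univ.erase i : Finset (Fin n)).sort (· ≤ ·)
  have key : gen i * (gen i * genProd A) = (-1 : ℝ) ^ (n - 1) • ((gen i * genProd A) * gen i) := by
    rw [mul_assoc (gen i) (genProd A), h, mul_smul_comm, smul_smul, ← mul_pow]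
    simp
  have h2 := gen_mul_blade_of_notMem (Finset.notMem_erase i (Finset.univ : Finset (Fin n)))
  rw [Finset.insert_erase (Finset.mem_univ i), blade_eq_genProd] at h2
  rcases h2 with h2 | h2
  · rw [pseudo, ← h2]; exact key
  · rw [pseudo, ← neg_eq_iff_eq_neg.2 h2, mul_neg, key, neg_mul, smul_neg]

lemma vec_mul_pseudo (x : E n) : vec x * pseudo n = (-1 : ℝ) ^ (n - 1) • (pseudo n * vec x) := by
  simp only [vec_eq_sum, Finset.sum_mul, Finset.mul_sum, Finset.smul_sum, smul_mul_assoc,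
    mul_smul_comm, gen_mul_pseudo]
  exact Finset.sum_congr rfl fun i _ => smul_comm _ _ _

lemma mul_pseudo_of_odd (hn : Odd n) (M : Cl n) : M * pseudo n = pseudo n * M := by
  have he : Even (n - 1) := by obtain ⟨k, hk⟩ := hn; exact ⟨k, by omega⟩
  induction M using CliffordAlgebra.left_induction with
  | algebraMap r => exact Algebra.commutes r _
  | add x y hx hy => rw [add_mul, mul_add, hx, hy]
  | ι_mul x m hx =>
    have := vec_mul_pseudo m
    rw [he.neg_one_pow, one_smul] at this
    rw [mul_assoc, hx, ← mul_assoc, ← mul_assoc]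
    exact congrArg (· * x) this

lemma mul_pseudo_of_even (h0 : n ≠ 0) (hn : Even n) (M : Cl n) :
    M * pseudo n = pseudo n * CliffordAlgebra.involute M := by
  have he : Odd (n - 1) := by obtain ⟨k, hk⟩ := hn; exact ⟨k - 1, by omega⟩
  induction M using CliffordAlgebra.left_induction with
  | algebraMap r => rw [AlgHom.commutes]; exact Algebra.commutes r _
  | add x y hx hy => rw [add_mul, map_add, mul_add, hx, hy]
  | ι_mul x m hx =>
    have := vec_mul_pseudo m
    rw [he.neg_one_pow, neg_one_smul, vec] at this
    rw [mul_assoc, hx, map_mul, CliffordAlgebra.involute_ι, ← mul_assoc, ← mul_assoc, this,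
      mul_neg, neg_mul]

lemma involute_pseudo (hn : Even n) : CliffordAlgebra.involute (pseudo n) = pseudo n := by
  have h : pseudo n = (((Finset.univ : Finset (Fin n)).sort (· ≤ ·)).map
      (fun i => EuclideanSpace.single i (1 : ℝ)) |>.map (CliffordAlgebra.ι (Q n))).prod := by
    rw [List.map_map]; rfl
  rw [h, CliffordAlgebra.involute_prod_map_ι, List.length_map, Finset.length_sort,
    Finset.card_univ, Fintype.card_fin, hn.neg_one_pow, one_smul]

/-! ### The Euclidean structure of `Clₙ` -/

lemma coord_add (A : Finset (Fin n)) (M N : Cl n) : coord A (M + N) = coord A M + coord A N := by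
  simp [coord, scalarProd, add_mul]

lemma coord_smul (A : Finset (Fin n)) (c : ℝ) (M : Cl n) : coord A (c • M) = c * coord A M := by
  simp [coord, scalarProd]

lemma coord_blade (A B : Finset (Fin n)) : coord A (blade B) = if B = A then 1 else 0 :=
  Sc_blade_mul_rev_blade B A

lemma sum_coord_smul_blade (M : Cl n) : ∑ A, coord A M • blade A = M := by
  let T : Cl n →ₗ[ℝ] Cl n :=
    ∑ A : Finset (Fin n), (LinearMap.toSpanSingleton ℝ (Cl n) (blade A)) ∘ₗ
      ({ toFun := coord A, map_add' := coord_add A, map_smul' := coord_smul A } : Cl n →ₗ[ℝ] ℝ)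
  have hT : T = LinearMap.id := by
    refine linearMap_ext_blade fun B => ?_
    simp [T, coord_blade]
  have := congrArg (fun S => S M) hT
  simpa [T] using this

/-- The blade coordinates as a linear isomorphism onto a Euclidean space. -/
def coordEquiv : Cl n ≃ₗ[ℝ] EuclideanSpace ℝ (Finset (Fin n)) where
  toFun M := WithLp.toLp 2 fun A => coord A M
  map_add' M N := by ext A; simp [coord_add]
  map_smul' c M := by ext A; simp [coord_smul]
  invFun v := ∑ A, v A • blade A
  left_inv M := sum_coord_smul_blade M
  right_inv v := by
    ext A
    change coord A (∑ B, v B • blade B) = v A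
    let T : Cl n →ₗ[ℝ] ℝ :=
      { toFun := coord A, map_add' := coord_add A, map_smul' := coord_smul A }
    change T (∑ B, v B • blade B) = v A
    rw [map_sum]
    have : ∀ B, T (v B • blade B) = if B = A then v B else 0 := fun B => by
      change coord A (v B • blade B) = _
      rw [coord_smul, coord_blade]; split_ifs <;> simp
    simp [this]

@[simp] lemma coordEquiv_apply (M : Cl n) (A : Finset (Fin n)) : coordEquiv M A = coord A M := rfl

/-- With the Euclidean norm of the blade coordinates, the coordinatewise integral, integrability and
$L^2$ notions of the statement become the Bochner ones. -/
instance : NormedAddCommGroup (Cl n) :=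
  NormedAddCommGroup.induced (Cl n) (EuclideanSpace ℝ (Finset (Fin n)))
    (coordEquiv : Cl n ≃ₗ[ℝ] _) coordEquiv.injective

lemma norm_eq (M : Cl n) : ‖M‖ = ‖coordEquiv M‖ := rfl

lemma norm_sq_eq_sum (M : Cl n) : ‖M‖ ^ 2 = ∑ A, coord A M ^ 2 := by
  rw [norm_eq, EuclideanSpace.norm_sq_eq]; simp

lemma Sc_mul_rev (M N : Cl n) : Sc (M * rev N) = ∑ A, coord A M * coord A N := by
  conv_lhs => rw [← sum_coord_smul_blade N]
  have h : rev (∑ A, coord A N • blade A) = ∑ A, coord A N • rev (blade A) := by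
    change CliffordAlgebra.reverse (∑ A, coord A N • blade A) = _
    rw [map_sum]
    simp only [map_smul]; rfl
  rw [h, Finset.mul_sum, ← ScL_apply, map_sum]
  refine Finset.sum_congr rfl fun A _ => ?_
  rw [mul_smul_comm, map_smul, smul_eq_mul, mul_comm]; rfl

instance : InnerProductSpace ℝ (Cl n) where
  norm_smul_le c M := by rw [norm_eq, norm_eq, map_smul, norm_smul]
  inner M N := Sc (M * rev N)
  norm_sq_eq_re_inner M := by
    rw [norm_sq_eq_sum, Sc_mul_rev]; simp [sq]
  conj_inner_symm M N := by
    change Sc (N * rev M) = Sc (M * rev N)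
    rw [← Sc_rev, rev_mul, rev_rev]
  add_left M N P := by simp [add_mul]
  smul_left M N c := by simp

lemma inner_eq (M N : Cl n) : inner ℝ M N = Sc (M * rev N) := rfl

lemma modSq_eq (M : Cl n) : modSq M = ‖M‖ ^ 2 := by
  rw [← real_inner_self_eq_norm_sq]; rfl

instance : FiniteDimensional ℝ (Cl n) := coordEquiv.symm.finiteDimensional

instance : MeasurableSpace (Cl n) := borel _

instance : BorelSpace (Cl n) := ⟨rfl⟩

/-- The coordinate along a blade as a continuous linear form. -/
def coordL (A : Finset (Fin n)) : Cl n →L[ℝ] ℝ :=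
  LinearMap.toContinuousLinearMap
    { toFun := coord A, map_add' := coord_add A, map_smul' := coord_smul A }

/-- Reversion as a continuous linear map. -/
def revL : Cl n →L[ℝ] Cl n := LinearMap.toContinuousLinearMap CliffordAlgebra.reverse

/-- The scalar part as a continuous linear form. -/
def ScC : Cl n →L[ℝ] ℝ := LinearMap.toContinuousLinearMap ScL

@[simp] lemma ScC_apply (M : Cl n) : ScC M = Sc M := rfl

/-- Multiplication as a continuous bilinear map. -/
def mulL : Cl n →L[ℝ] Cl n →L[ℝ] Cl n :=
  (LinearMap.mul ℝ (Cl n)).toContinuousBilinearMap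

@[simp] lemma mulL_apply (M N : Cl n) : mulL M N = M * N := rfl

lemma norm_mul_le' (M N : Cl n) : ‖M * N‖ ≤ ‖(mulL : Cl n →L[ℝ] _)‖ * ‖M‖ * ‖N‖ :=
  (mulL : Cl n →L[ℝ] _).le_opNorm₂ M N

lemma continuous_mul' : Continuous fun p : Cl n × Cl n => p.1 * p.2 :=
  (mulL : Cl n →L[ℝ] _).isBoundedBilinearMap.continuous

instance : ContinuousMul (Cl n) := ⟨continuous_mul'⟩

@[fun_prop] lemma continuous_rev : Continuous (rev : Cl n → Cl n) := revL.continuous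

/-- The adjoint of a multiplication is multiplication by the reverse; on the left this rests on
cyclicity of the scalar part. -/
lemma inner_mul_left_eq (M N P : Cl n) : inner ℝ (P * M) N = inner ℝ M (rev P * N) := by
  rw [inner_eq, inner_eq, rev_mul, rev_rev, mul_assoc, Sc_mul_comm, mul_assoc]

lemma inner_mul_right_eq (M N P : Cl n) : inner ℝ (M * P) N = inner ℝ M (N * rev P) := by
  rw [inner_eq, inner_eq, rev_mul, rev_rev, mul_assoc]

lemma norm_vec_mul (x : E n) (M : Cl n) : ‖vec x * M‖ = ‖x‖ * ‖M‖ := by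
  rw [← sq_eq_sq₀ (norm_nonneg _) (by positivity), mul_pow, ← real_inner_self_eq_norm_sq,
    inner_mul_left_eq, rev_vec, ← mul_assoc, vec_mul_self, smul_mul_assoc, one_mul,
    real_inner_smul_right, real_inner_self_eq_norm_sq]

/-! ### Integration -/

section Integration

lemma eq_sum_coord {X : Type*} (F : X → Cl n) : F = fun x => ∑ A, coord A (F x) • blade A :=
  funext fun x => (sum_coord_smul_blade (F x)).symm

variable {X : Type*} [MeasurableSpace X] {μ : Measure X} {F G : X → Cl n}

lemma clIntegrable_iff : ClIntegrable F μ ↔ Integrable F μ := by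
  refine ⟨fun h => ?_, fun h A => (coordL A).integrable_comp h⟩
  rw [eq_sum_coord F]
  exact integrable_finsetSum _ fun A _ => (h A).smul_const _

lemma clIntegral_eq (h : Integrable F μ) : clIntegral μ F = ∫ x, F x ∂μ := by
  rw [clIntegral, ← sum_coord_smul_blade (∫ x, F x ∂μ)]
  refine Finset.sum_congr rfl fun A _ => ?_
  congr 1
  exact (coordL A).integral_comp_comm h

lemma isL2_iff : IsL2 F μ ↔ MemLp F 2 μ := by
  refine ⟨fun h => ?_, fun h A => (coordL A).comp_memLp' h⟩
  rw [eq_sum_coord F]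
  exact memLp_finsetSum _ fun A _ =>
    ((ContinuousLinearMap.toSpanSingleton ℝ (blade A : Cl n)).comp_memLp' (h A))

lemma ofReal_modSq (M : Cl n) : ENNReal.ofReal (modSq M) = ‖M‖ₑ ^ 2 := by
  rw [modSq_eq, ← ofReal_norm, ENNReal.ofReal_pow (norm_nonneg _)]

lemma normSqL2_eq : normSqL2 μ F = ∫⁻ x, ‖F x‖ₑ ^ 2 ∂μ := by
  simp only [normSqL2, ofReal_modSq]

lemma memLp_mul_integrable (hF : MemLp F 2 μ) (hG : MemLp G 2 μ) :
    Integrable (fun x => F x * G x) μ := by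
  have h := (hF.norm.integrable_mul hG.norm).const_mul ‖(mulL : Cl n →L[ℝ] _)‖
  refine h.mono ?_ ?_
  · exact continuous_mul'.comp_aestronglyMeasurable₂ hF.1 hG.1
  · refine Eventually.of_forall fun x => ?_
    refine (norm_mul_le' _ _).trans (le_trans (le_of_eq ?_) (le_abs_self _))
    simp [mul_assoc]

lemma memLp_rev (hF : MemLp F 2 μ) : MemLp (fun x => rev (F x)) 2 μ := revL.comp_memLp' hF

lemma innerCl_eq (hF : MemLp F 2 μ) (hG : MemLp G 2 μ) :
    innerCl μ F G = ∫ x, F x * rev (G x) ∂μ :=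
  clIntegral_eq (memLp_mul_integrable hF (memLp_rev hG))

end Integration

/-! ### The exponential and the complex coordinates -/

lemma continuous_expI : Continuous (expI : ℝ → Cl n) := by
  exact (Real.continuous_cos.smul (continuous_const (y := (1 : Cl n)))).add
    (Real.continuous_sin.smul (continuous_const (y := pseudo n)))

@[simp] lemma expI_zero : expI 0 = (1 : Cl n) := by simp [expI]

lemma expI_add (hn : n % 4 = 2 ∨ n % 4 = 3) (s t : ℝ) :
    expI (s + t) = (expI s * expI t : Cl n) := by
  simp only [expI, Real.cos_add, Real.sin_add, add_mul, mul_add, smul_mul_smul_comm, one_mul,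
    mul_one, pseudo_mul_self hn]
  module

lemma rev_expI (hn : n % 4 = 2 ∨ n % 4 = 3) (t : ℝ) : rev (expI t : Cl n) = expI (-t) := by
  simp [expI, rev_pseudo hn]

lemma norm_mul_expI (hn : n % 4 = 2 ∨ n % 4 = 3) (M : Cl n) (t : ℝ) : ‖M * expI t‖ = ‖M‖ := by
  rw [← sq_eq_sq₀ (norm_nonneg _) (norm_nonneg _), ← real_inner_self_eq_norm_sq,
    inner_mul_right_eq, rev_expI hn, mul_assoc, ← expI_add hn, add_neg_cancel, expI_zero, mul_one,
    real_inner_self_eq_norm_sq]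

/-- $Mi_n\perp M$ gives $|Me^{i_ns}-M|^2=2(1-\cos s)|M|^2\le s^2|M|^2$. -/
lemma norm_mul_expI_sub_le (M : Cl n) (s : ℝ) (hn : n % 4 = 2 ∨ n % 4 = 3) :
    ‖M * expI s - M‖ ≤ |s| * ‖M‖ := by
  rw [← sq_le_sq₀ (norm_nonneg _) (by positivity), mul_pow, sq_abs, norm_sub_sq_real,
    norm_mul_expI hn]
  have h1 : inner ℝ (M * expI s) M = Real.cos s * ‖M‖ ^ 2 := by
    have h0 : inner ℝ (M * pseudo n) M = 0 := by
      have h := inner_mul_right_eq M M (pseudo n)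
      rw [rev_pseudo hn, mul_neg, inner_neg_right, real_inner_comm] at h
      rw [real_inner_comm]; linarith
    rw [expI, mul_add, mul_smul_comm, mul_smul_comm, mul_one, inner_add_left, real_inner_smul_left,
      real_inner_smul_left, h0, real_inner_self_eq_norm_sq]; ring
  rw [h1]
  have := Real.one_sub_sq_div_two_le_cos (x := s)
  nlinarith [sq_nonneg ‖M‖]

/-- The complex coordinate along a blade, for the complex structure on `Clₙ` given by right
multiplication by the pseudoscalar. -/
def cCoord (A : Finset (Fin n)) : Cl n →L[ℝ] ℂ :=
  LinearMap.toContinuousLinearMap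
    -- The minus sign makes right multiplication by $i_n$ correspond to multiplication by $i$.
    { toFun := fun M => ⟨coord A M, -coord A (M * pseudo n)⟩
      map_add' := fun M N => by
        apply Complex.ext <;> simp [coord_add, add_mul]; ring
      map_smul' := fun c M => by
        apply Complex.ext <;> simp [coord_smul] }

lemma cCoord_apply (A : Finset (Fin n)) (M : Cl n) :
    cCoord A M = ⟨coord A M, -coord A (M * pseudo n)⟩ := rfl

lemma cCoord_mul_expI (hn : n % 4 = 2 ∨ n % 4 = 3) (A : Finset (Fin n)) (M : Cl n) (t : ℝ) :
    cCoord A (M * expI t) = Complex.exp (t * Complex.I) * cCoord A M := by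
  have h : M * expI t * pseudo n = Real.cos t • (M * pseudo n) - Real.sin t • M := by
    simp only [expI, mul_add, add_mul, mul_smul_comm, smul_mul_assoc, mul_one, mul_assoc,
      pseudo_mul_self hn, mul_neg, smul_neg]; abel
  have h2 : M * expI t = Real.cos t • M + Real.sin t • (M * pseudo n) := by
    simp only [expI, mul_add, mul_smul_comm, mul_one]
  have hs : ∀ a b : Cl n, coord A (a - b) = coord A a - coord A b := map_sub (coordL A)
  rw [cCoord_apply, cCoord_apply, h, h2]
  apply Complex.ext <;> simp only [Complex.mul_re, Complex.mul_im, Complex.exp_ofReal_mul_I_re,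
    Complex.exp_ofReal_mul_I_im, coord_add, coord_smul, hs] <;> ring

/-- The factor 2 appears because the real parts sum to $|M|^2$ and the imaginary parts to
$|Mi_n|^2=|M|^2$. -/
lemma sum_cCoord_sq (hn : n % 4 = 2 ∨ n % 4 = 3) (M : Cl n) :
    ∑ A, ‖cCoord A M‖ ^ 2 = 2 * ‖M‖ ^ 2 := by
  have h1 : ‖M * pseudo n‖ = ‖M‖ := by
    have := norm_mul_expI hn M (Real.pi / 2)
    simpa [expI] using this
  have h2 : ∀ A, ‖cCoord A M‖ ^ 2 = coord A M ^ 2 + coord A (M * pseudo n) ^ 2 := fun A => by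
    rw [cCoord_apply, ← Complex.normSq_eq_norm_sq, Complex.normSq_mk]; ring
  rw [two_mul]
  conv_rhs => arg 2; rw [← h1]
  rw [norm_sq_eq_sum, norm_sq_eq_sum, ← Finset.sum_add_distrib]
  exact Finset.sum_congr rfl fun A _ => h2 A

/-! ### Plancherel for integrable functions -/

open FourierTransform SchwartzMap in
/-- On `L¹ ∩ L²` the `L²` Fourier transform is given by the Fourier integral. -/
lemma fourier_toLp_ae_eq {V : Type*} [NormedAddCommGroup V] [InnerProductSpace ℝ V]
    [FiniteDimensional ℝ V] [MeasurableSpace V] [BorelSpace V] {u : V → ℂ} (h1 : Integrable u)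
    (h2 : MemLp u 2) : (𝓕 (h2.toLp u) : Lp ℂ 2 (volume : Measure V)) =ᵐ[volume] 𝓕 u := by
  -- Testing against smooth compactly supported $g$ suffices. On both sides the transform moves onto
  -- $g$: for the $L^2$ transform through tempered distributions, for the integral by the
  -- multiplication formula.
  refine ae_eq_of_integral_contDiff_smul_eq
    ((Lp.memLp _).locallyIntegrable (by norm_num)) ?_ fun g hg hgs => ?_
  · exact (VectorFourier.fourierIntegral_continuous Real.continuous_fourierChar
      (by exact continuous_inner) h1).locallyIntegrable
  · have hgs' : HasCompactSupport (fun x => (g x : ℂ)) := hgs.comp_left Complex.ofReal_zero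
    let φ : 𝓢(V, ℂ) := hgs'.toSchwartzMap (Complex.ofRealCLM.contDiff.comp hg)
    have hφ : ∀ x, φ x = (g x : ℂ) := fun x => rfl
    have e1 : ∫ x, φ x • (𝓕 (h2.toLp u) : Lp ℂ 2 (volume : Measure V)) x =
        ∫ x, (𝓕 φ) x • (h2.toLp u) x := by
      rw [← Lp.toTemperedDistribution_apply, ← Lp.toTemperedDistribution_apply,
        ← Lp.fourier_toTemperedDistribution_eq, TemperedDistribution.fourier_apply]
    have e2 : ∫ x, (𝓕 φ) x • (h2.toLp u) x = ∫ x, (𝓕 φ) x • u x :=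
      integral_congr_ae (h2.coeFn_toLp.mono fun x hx => by simp only [hx])
    have e3 : ∫ x, (𝓕 φ) x • u x = ∫ x, φ x • 𝓕 u x := by
      have := VectorFourier.integral_fourierIntegral_smul_eq_flip (f := φ) (g := u)
        (L := innerₗ V) (μ := volume) (ν := volume) Real.continuous_fourierChar
        (by exact continuous_inner) φ.integrable h1
      rw [flip_innerₗ] at this
      exact this
    simpa [hφ] using (e1.trans e2).trans e3

lemma eLpNorm_fourier_eq {V : Type*} [NormedAddCommGroup V] [InnerProductSpace ℝ V]
    [FiniteDimensional ℝ V] [MeasurableSpace V] [BorelSpace V] {u : V → ℂ} (h1 : Integrable u)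
    (h2 : MemLp u 2) :
    eLpNorm (FourierTransform.fourier u) 2 = eLpNorm u 2 (volume : Measure V) := by
  rw [← eLpNorm_congr_ae (fourier_toLp_ae_eq h1 h2), ← eLpNorm_congr_ae h2.coeFn_toLp,
    ← ENNReal.toReal_eq_toReal_iff' (Lp.eLpNorm_ne_top _) (Lp.eLpNorm_ne_top _), ← Lp.norm_def,
    ← Lp.norm_def, Lp.norm_fourier_eq]

lemma eLpNorm_two_sq {X V : Type*} [MeasurableSpace X] [NormedAddCommGroup V] (μ : Measure X)
    (f : X → V) : eLpNorm f 2 μ ^ 2 = ∫⁻ x, ‖f x‖ₑ ^ 2 ∂μ := by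
  have := eLpNorm_nnreal_pow_eq_lintegral (f := f) (μ := μ) (p := 2) two_ne_zero
  simpa using this

lemma lintegral_comp_smul (g : E n → ℝ≥0∞) {c : ℝ} (hc : c ≠ 0) :
    ∫⁻ x, g (c • x) = ENNReal.ofReal |(c ^ n)⁻¹| * ∫⁻ x, g x := by
  have h := Measure.map_addHaar_smul (volume : Measure (E n)) hc
  rw [finrank_euclideanSpace, Fintype.card_fin] at h
  rw [← smul_eq_mul, ← lintegral_smul_measure, ← h]
  exact (lintegral_map_equiv g (Homeomorph.smulOfNeZero c hc).toMeasurableEquiv).symm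

/-- The Clifford Fourier integral as a Bochner integral. -/
def cftI (u : E n → Cl n) (ω : E n) : Cl n := ∫ x, u x * expI (-(inner ℝ ω x))

section

variable (hn : n % 4 = 2 ∨ n % 4 = 3) {u v : E n → Cl n}

lemma aestronglyMeasurable_mul_expI (hu : AEStronglyMeasurable u) (φ : E n → ℝ)
    (hφ : Continuous φ) : AEStronglyMeasurable (fun x => u x * expI (φ x)) :=
  continuous_mul'.comp_aestronglyMeasurable₂ hu
    (continuous_expI.comp hφ).aestronglyMeasurable

include hn

lemma integrable_mul_expI (hu : Integrable u) (φ : E n → ℝ) (hφ : Continuous φ) :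
    Integrable (fun x => u x * expI (φ x)) :=
  hu.mono (aestronglyMeasurable_mul_expI hu.1 φ hφ)
    (Eventually.of_forall fun _ => (norm_mul_expI hn _ _).le)

lemma memLp_mul_expI (hu : MemLp u 2) (φ : E n → ℝ) (hφ : Continuous φ) :
    MemLp (fun x => u x * expI (φ x)) 2 :=
  hu.of_le (aestronglyMeasurable_mul_expI hu.1 φ hφ)
    (Eventually.of_forall fun _ => (norm_mul_expI hn _ _).le)

lemma cftIntegral_eq (hu : Integrable u) : cftIntegral u = cftI u :=
  funext fun ω => clIntegral_eq (integrable_mul_expI hn hu _ (by fun_prop))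

lemma continuous_cftI (hu : Integrable u) : Continuous (cftI u) := by
  refine continuous_of_dominated (bound := fun x => ‖u x‖)
    (fun ω => (integrable_mul_expI hn hu _ (by fun_prop)).1)
    (fun ω => Eventually.of_forall fun x => (norm_mul_expI hn _ _).le) hu.norm
    (Eventually.of_forall fun x => ?_)
  exact (mulL (u x)).continuous.comp (continuous_expI.comp (by fun_prop))

lemma cCoord_cftI (hu : Integrable u) (A : Finset (Fin n)) (ω : E n) :
    cCoord A (cftI u ω) =
      FourierTransform.fourier (fun x => cCoord A (u x)) ((2 * Real.pi)⁻¹ • ω) := by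
  rw [cftI, ← (cCoord A).integral_comp_comm (integrable_mul_expI hn hu _ (by fun_prop)),
    Real.fourier_eq']
  refine integral_congr_ae (Eventually.of_forall fun x => ?_)
  simp only [cCoord_mul_expI hn, smul_eq_mul]
  congr 3
  rw [inner_smul_right, real_inner_comm]
  have := Real.pi_ne_zero
  field_simp

lemma sum_cCoord_enorm_sq (M : Cl n) : ∑ A, ‖cCoord A M‖ₑ ^ 2 = 2 * ‖M‖ₑ ^ 2 := by
  have h := congrArg ENNReal.ofReal (sum_cCoord_sq hn M)
  rw [ENNReal.ofReal_sum_of_nonneg (fun _ _ => by positivity),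
    ENNReal.ofReal_mul zero_le_two, ENNReal.ofReal_pow (norm_nonneg _), ofReal_norm,
    ENNReal.ofReal_ofNat] at h
  rw [← h]
  exact Finset.sum_congr rfl fun A _ => by rw [ENNReal.ofReal_pow (norm_nonneg _), ofReal_norm]

/-- Plancherel's theorem for the Clifford Fourier integral on `L¹ ∩ L²`. -/
lemma lintegral_cftI_sq (h1 : Integrable u) (h2 : MemLp u 2) :
    ∫⁻ ω, ‖cftI u ω‖ₑ ^ 2 = ENNReal.ofReal ((2 * Real.pi) ^ n) * ∫⁻ x, ‖u x‖ₑ ^ 2 := by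
  have key : ∀ A, ∫⁻ ω, ‖cCoord A (cftI u ω)‖ₑ ^ 2 =
      ENNReal.ofReal ((2 * Real.pi) ^ n) * ∫⁻ x, ‖cCoord A (u x)‖ₑ ^ 2 := fun A => by
    simp only [cCoord_cftI hn h1]
    rw [lintegral_comp_smul (fun ω => ‖FourierTransform.fourier (fun x => cCoord A (u x)) ω‖ₑ ^ 2)
      (by positivity), ← eLpNorm_two_sq, ← eLpNorm_two_sq,
      eLpNorm_fourier_eq ((cCoord A).integrable_comp h1) ((cCoord A).comp_memLp' h2)]
    -- The normalization $e^{-2\pi i x\cdot\xi}$ of the ordinary transform forces $\xi=\omega/2\pi$,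
    -- whose Jacobian is the constant $(2\pi)^n$.
    congr 2
    rw [inv_pow, inv_inv, abs_of_pos (by positivity)]
  have hm : ∀ {w : E n → Cl n}, AEMeasurable w → ∀ A ∈ (Finset.univ : Finset (Finset (Fin n))),
      AEMeasurable fun x => ‖cCoord A (w x)‖ₑ ^ 2 := fun hw A _ =>
    ((cCoord A).continuous.measurable.comp_aemeasurable hw).enorm.pow_const 2
  have h := Finset.sum_congr rfl (fun A (_ : A ∈ Finset.univ) => key A)
  rw [← Finset.mul_sum, ← lintegral_finsetSum' _ (hm (continuous_cftI hn h1).aemeasurable),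
    ← lintegral_finsetSum' _ (hm h1.1.aemeasurable)] at h
  simp only [sum_cCoord_enorm_sq hn] at h
  rw [lintegral_const_mul' _ _ (by simp), lintegral_const_mul' _ _ (by simp), mul_left_comm] at h
  exact (ENNReal.mul_right_inj two_ne_zero (by simp)).1 h

lemma cftI_sub (hu : Integrable u) (hv : Integrable v) : cftI (u - v) = cftI u - cftI v := by
  ext1 ω
  simp only [cftI, Pi.sub_apply, sub_mul]
  exact integral_sub (integrable_mul_expI hn hu _ (by fun_prop))
    (integrable_mul_expI hn hv _ (by fun_prop))

lemma cftI_add (hu : Integrable u) (hv : Integrable v) : cftI (u + v) = cftI u + cftI v := by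
  ext1 ω
  simp only [cftI, Pi.add_apply, add_mul]
  exact integral_add (integrable_mul_expI hn hu _ (by fun_prop))
    (integrable_mul_expI hn hv _ (by fun_prop))

lemma eLpNorm_cftI (h1 : Integrable u) (h2 : MemLp u 2) :
    eLpNorm (cftI u) 2 = ENNReal.ofReal (√((2 * Real.pi) ^ n)) * eLpNorm u 2 := by
  have h := lintegral_cftI_sq hn h1 h2
  rw [← eLpNorm_two_sq, ← eLpNorm_two_sq, ← Real.sq_sqrt (show 0 ≤ (2 * Real.pi) ^ n by positivity),
    ENNReal.ofReal_pow (Real.sqrt_nonneg _), ← mul_pow] at h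
  exact (ENNReal.pow_right_strictMono two_ne_zero).injective h

lemma memLp_cftI (h1 : Integrable u) (h2 : MemLp u 2) : MemLp (cftI u) 2 := by
  refine ⟨(continuous_cftI hn h1).aestronglyMeasurable, ?_⟩
  rw [eLpNorm_cftI hn h1 h2]
  exact ENNReal.mul_lt_top ENNReal.ofReal_lt_top h2.2

end

/-! ### The Clifford Fourier transform on `L²` -/

/-- `(f, F)` lies in the `L²` closure of the graph of the Clifford Fourier integral on
`L¹ ∩ L²`. -/
structure IsL2CFT (f F : E n → Cl n) : Prop where
  memLp : MemLp f 2
  memLp' : MemLp F 2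
  exists_seq : ∃ u : ℕ → E n → Cl n, (∀ k, Integrable (u k)) ∧ (∀ k, MemLp (u k) 2) ∧
    Tendsto (fun k => eLpNorm (u k - f) 2) atTop (𝓝 0) ∧
    Tendsto (fun k => eLpNorm (cftI (u k) - F) 2) atTop (𝓝 0)

namespace IsL2CFT

variable {f F g G : E n → Cl n}

lemma add (hn : n % 4 = 2 ∨ n % 4 = 3) (h : IsL2CFT f F) (h' : IsL2CFT g G) :
    IsL2CFT (f + g) (F + G) := by
  obtain ⟨u, u1, u2, u3, u4⟩ := h.exists_seq
  obtain ⟨v, v1, v2, v3, v4⟩ := h'.exists_seq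
  refine ⟨h.memLp.add h'.memLp, h.memLp'.add h'.memLp', fun k => u k + v k,
    fun k => (u1 k).add (v1 k), fun k => (u2 k).add (v2 k), ?_, ?_⟩
  · refine tendsto_of_tendsto_of_tendsto_of_le_of_le tendsto_const_nhds
      (by simpa using u3.add v3) (fun _ => zero_le) fun k => ?_
    have e : u k + v k - (f + g) = (u k - f) + (v k - g) := by abel
    simp only [e]
    exact eLpNorm_add_le ((u2 k).sub h.memLp).1 ((v2 k).sub h'.memLp).1 one_le_two
  · refine tendsto_of_tendsto_of_tendsto_of_le_of_le tendsto_const_nhds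
      (by simpa using u4.add v4) (fun _ => zero_le) fun k => ?_
    have e : cftI (u k + v k) - (F + G) = (cftI (u k) - F) + (cftI (v k) - G) := by
      rw [cftI_add hn (u1 k) (v1 k)]; abel
    simp only [e]
    exact eLpNorm_add_le ((memLp_cftI hn (u1 k) (u2 k)).sub h.memLp').1
      ((memLp_cftI hn (v1 k) (v2 k)).sub h'.memLp').1 one_le_two

/-- Post-composition with a linear map that commutes with right multiplication by the
exponentials. -/
lemma clm (hn : n % 4 = 2 ∨ n % 4 = 3) (h : IsL2CFT f F) (L : Cl n →L[ℝ] Cl n)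
    (hL : ∀ M t, L (M * expI t) = L M * expI t) :
    IsL2CFT (fun x => L (f x)) (fun x => L (F x)) := by
  obtain ⟨u, u1, u2, u3, u4⟩ := h.exists_seq
  have e : ∀ k, cftI (fun x => L (u k x)) = fun ω => L (cftI (u k) ω) := fun k => by
    ext1 ω
    simp only [cftI, ← hL]
    exact L.integral_comp_comm (integrable_mul_expI hn (u1 k) _ (by fun_prop))
  have hb : ∀ w : E n → Cl n, eLpNorm (fun x => L (w x)) 2 ≤ ‖L‖ₑ * eLpNorm w 2 :=
    fun w => by
      rw [← ofReal_norm]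
      exact eLpNorm_le_mul_eLpNorm_of_ae_le_mul (Eventually.of_forall fun x => L.le_opNorm _) 2
  refine ⟨L.comp_memLp' h.memLp, L.comp_memLp' h.memLp', fun k x => L (u k x),
    fun k => L.integrable_comp (u1 k), fun k => L.comp_memLp' (u2 k), ?_, ?_⟩
  · refine tendsto_of_tendsto_of_tendsto_of_le_of_le tendsto_const_nhds
      (by simpa using ENNReal.Tendsto.const_mul u3 (Or.inr (enorm_ne_top (x := L))))
      (fun _ => zero_le) fun k => ?_
    refine le_trans (le_of_eq ?_) (hb (u k - f))
    congr 1; ext1 x; simp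
  · refine tendsto_of_tendsto_of_tendsto_of_le_of_le tendsto_const_nhds
      (by simpa using ENNReal.Tendsto.const_mul u4 (Or.inr (enorm_ne_top (x := L))))
      (fun _ => zero_le) fun k => ?_
    refine le_trans (le_of_eq ?_) (hb (cftI (u k) - F))
    rw [e]
    congr 1; ext1 x; simp

lemma neg (hn : n % 4 = 2 ∨ n % 4 = 3) (h : IsL2CFT f F) : IsL2CFT (-f) (-F) := by
  have := h.clm hn (-ContinuousLinearMap.id ℝ _) (fun M t => by simp)
  exact this

lemma sub (hn : n % 4 = 2 ∨ n % 4 = 3) (h : IsL2CFT f F) (h' : IsL2CFT g G) :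
    IsL2CFT (f - g) (F - G) := by
  rw [sub_eq_add_neg, sub_eq_add_neg]
  exact h.add hn (h'.neg hn)

lemma eLpNorm_eq (hn : n % 4 = 2 ∨ n % 4 = 3) (h : IsL2CFT f F) :
    eLpNorm F 2 = ENNReal.ofReal (√((2 * Real.pi) ^ n)) * eLpNorm f 2 := by
  obtain ⟨u, u1, u2, u3, u4⟩ := h.exists_seq
  have t1 := ((Lp.tendsto_Lp_iff_tendsto_eLpNorm'' u u2 f h.memLp).2 u3).enorm
  have t2 := ((Lp.tendsto_Lp_iff_tendsto_eLpNorm'' (fun k => cftI (u k))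
    (fun k => memLp_cftI hn (u1 k) (u2 k)) F h.memLp').2 u4).enorm
  simp only [Lp.enorm_toLp] at t1 t2
  refine tendsto_nhds_unique t2 ?_
  simp only [eLpNorm_cftI hn (u1 _) (u2 _)]
  exact ENNReal.Tendsto.const_mul t1 (Or.inr ENNReal.ofReal_ne_top)

/-- The closed graph is linear, and by the norm identity only a null function lies over a null
function. -/
lemma unique (hn : n % 4 = 2 ∨ n % 4 = 3) (h : IsL2CFT f F) (h' : IsL2CFT g G)
    (hfg : f =ᵐ[volume] g) : F =ᵐ[volume] G := by
  have := (h.sub hn h').eLpNorm_eq hn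
  have h0 : eLpNorm (f - g) 2 = 0 :=
    (eLpNorm_eq_zero_iff (h.memLp.sub h'.memLp).1 two_ne_zero).2 (by
      filter_upwards [hfg] with x hx; simp [hx])
  rw [h0, mul_zero, eLpNorm_eq_zero_iff (h.memLp'.sub h'.memLp').1 two_ne_zero] at this
  filter_upwards [this] with x hx
  exact sub_eq_zero.1 hx

lemma integral_norm_sq (hn : n % 4 = 2 ∨ n % 4 = 3) (h : IsL2CFT f F) :
    ∫ ω, ‖F ω‖ ^ 2 = (2 * Real.pi) ^ n * ∫ x, ‖f x‖ ^ 2 := by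
  have e := congrArg (fun t => t ^ 2) (h.eLpNorm_eq hn)
  beta_reduce at e
  rw [mul_pow, eLpNorm_two_sq, eLpNorm_two_sq, ← ENNReal.ofReal_pow (Real.sqrt_nonneg _),
    Real.sq_sqrt (show 0 ≤ (2 * Real.pi) ^ n by positivity)] at e
  rw [integral_eq_lintegral_of_nonneg_ae (Eventually.of_forall fun _ => by positivity)
      h.memLp'.norm.integrable_sq.1,
    integral_eq_lintegral_of_nonneg_ae (Eventually.of_forall fun _ => by positivity)
      h.memLp.norm.integrable_sq.1]
  simp only [ENNReal.ofReal_pow (norm_nonneg _), ofReal_norm]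
  rw [e, ENNReal.toReal_mul, ENNReal.toReal_ofReal (by positivity)]

/-- Plancherel's theorem, polarized. -/
lemma integral_inner (hn : n % 4 = 2 ∨ n % 4 = 3) (h : IsL2CFT f F) (h' : IsL2CFT g G) :
    ∫ ω, inner ℝ (F ω) (G ω) = (2 * Real.pi) ^ n * ∫ x, inner ℝ (f x) (g x) := by
  have e1 := (h.add hn h').integral_norm_sq hn
  have e2 := (h.sub hn h').integral_norm_sq hn
  have pol : ∀ {u v : E n → Cl n}, MemLp u 2 → MemLp v 2 → ∫ x, inner ℝ (u x) (v x) =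
      ((∫ x, ‖(u + v) x‖ ^ 2) - ∫ x, ‖(u - v) x‖ ^ 2) / 4 := fun {u v} hu hv => by
    rw [← integral_sub (hu.add hv).norm.integrable_sq (hu.sub hv).norm.integrable_sq,
      ← integral_div]
    refine integral_congr_ae (Eventually.of_forall fun x => ?_)
    simp only [Pi.add_apply, Pi.sub_apply]
    rw [norm_add_sq_real, norm_sub_sq_real]; ring
  rw [pol h.memLp' h'.memLp', pol h.memLp h'.memLp, e1, e2]; ring

/-- Plancherel's theorem for the multivector valued inner product. -/
lemma integral_mul_rev (hn : n % 4 = 2 ∨ n % 4 = 3) (h : IsL2CFT f F) (h' : IsL2CFT g G) :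
    ∫ ω, F ω * rev (G ω) = ((2 * Real.pi) ^ n) • ∫ x, f x * rev (g x) := by
  -- Pairing with $N$ reduces to the real inner product, since left multiplication by $N$ commutes
  -- with the right exponentials.
  refine ext_inner_left ℝ fun N => ?_
  have e : ∀ a b : Cl n, inner ℝ N (a * rev b) = inner ℝ a (N * b) := fun a b => by
    rw [real_inner_comm, inner_mul_right_eq, rev_rev]
  rw [inner_smul_right, ← _root_.integral_inner (memLp_mul_integrable h.memLp' (memLp_rev h'.memLp')),
    ← _root_.integral_inner (memLp_mul_integrable h.memLp (memLp_rev h'.memLp))]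
  simp only [e]
  exact h.integral_inner hn (h'.clm hn (mulL N) fun M t => (mul_assoc N M _).symm)

end IsL2CFT

/-! ### Existence of the transform -/

lemma tendsto_zero_of_sq {ι : Type*} {l : Filter ι} {x : ι → ℝ≥0∞}
    (h : Tendsto (fun i => x i ^ 2) l (𝓝 0)) : Tendsto x l (𝓝 0) := by
  have := (ENNReal.continuous_rpow_const (y := (1 / 2 : ℝ))).tendsto 0 |>.comp h
  rw [ENNReal.zero_rpow_of_pos (by norm_num)] at this
  refine this.congr fun i => ?_
  rw [Function.comp_apply, ← ENNReal.rpow_natCast, ← ENNReal.rpow_mul]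
  norm_num

section Existence

variable {f F : E n → Cl n}

lemma integrable_indicator_ball (hf : MemLp f 2) (R : ℝ) :
    Integrable ((Metric.ball (0 : E n) R).indicator f) := by
  rw [integrable_indicator_iff measurableSet_ball]
  have : IsFiniteMeasure (volume.restrict (Metric.ball (0 : E n) R)) :=
    ⟨by simpa using measure_ball_lt_top⟩
  exact (hf.restrict _).integrable one_le_two

lemma memLp_indicator_ball (hf : MemLp f 2) (R : ℝ) :
    MemLp ((Metric.ball (0 : E n) R).indicator f) 2 := hf.indicator measurableSet_ball

lemma tendsto_indicator_ball (hf : MemLp f 2) :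
    Tendsto (fun R : ℝ => eLpNorm ((Metric.ball (0 : E n) R).indicator f - f) 2) atTop (𝓝 0) := by
  refine tendsto_zero_of_sq ?_
  · simp only [eLpNorm_two_sq]
    rw [← lintegral_zero (μ := (volume : Measure (E n)))]
    refine tendsto_lintegral_filter_of_dominated_convergence' (fun x => ‖f x‖ₑ ^ 2)
      (Eventually.of_forall fun R => ?_)
      (Eventually.of_forall fun R => Eventually.of_forall fun x => ?_) ?_
      (Eventually.of_forall fun x => ?_)
    · exact ((memLp_indicator_ball hf R).sub hf).1.aemeasurable.enorm.pow_const 2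
    · gcongr
      simp only [Pi.sub_apply]
      by_cases hx : x ∈ Metric.ball (0 : E n) R <;> simp [hx]
    · rw [← eLpNorm_two_sq]
      exact ENNReal.pow_ne_top hf.2.ne
    · refine tendsto_const_nhds.congr' ?_
      filter_upwards [eventually_gt_atTop ‖x‖] with R hR
      have : x ∈ Metric.ball (0 : E n) R := by simpa using hR
      simp [this]

variable (hn : n % 4 = 2 ∨ n % 4 = 3)
include hn

lemma normSqL2_sub_cftIntegral (hf : MemLp f 2) (F : E n → Cl n) (R : ℝ) :
    (normSqL2 volume fun ω => F ω - cftIntegral ((Metric.ball (0 : E n) R).indicator f) ω) =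
      eLpNorm (cftI ((Metric.ball (0 : E n) R).indicator f) - F) 2 ^ 2 := by
  rw [normSqL2_eq, cftIntegral_eq hn (integrable_indicator_ball hf R), eLpNorm_two_sq]
  refine lintegral_congr fun ω => ?_
  rw [Pi.sub_apply, ← enorm_neg, neg_sub]

lemma IsCFT.isL2CFT (hf : MemLp f 2) (h : IsCFT f F) : IsL2CFT f F := by
  refine ⟨hf, isL2_iff.1 h.1, fun k => (Metric.ball (0 : E n) k).indicator f,
    fun k => integrable_indicator_ball hf k, fun k => memLp_indicator_ball hf k,
    (tendsto_indicator_ball hf).comp tendsto_natCast_atTop_atTop, ?_⟩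
  have h2 := h.2.comp (tendsto_natCast_atTop_atTop (R := ℝ))
  simp only [Function.comp_def, normSqL2_sub_cftIntegral hn hf F] at h2
  exact tendsto_zero_of_sq h2

/-- On $L^1\cap L^2$ the Fourier integral multiplies $L^2$ distances by $\kappa=(2\pi)^{n/2}$, so
the transforms of the truncations are Cauchy. This makes the choice defining `cft` a genuine
transform. -/
lemma exists_isCFT (hf : MemLp f 2) : ∃ F, IsCFT f F := by
  let u : ℝ → E n → Cl n := fun R => (Metric.ball (0 : E n) R).indicator f
  have u1 : ∀ R, Integrable (u R) := fun R => integrable_indicator_ball hf R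
  have u2 : ∀ R, MemLp (u R) 2 := fun R => memLp_indicator_ball hf R
  let U : ℝ → Lp (Cl n) 2 (volume : Measure (E n)) := fun R => (u2 R).toLp (u R)
  let V : ℝ → Lp (Cl n) 2 (volume : Measure (E n)) := fun R =>
    (memLp_cftI hn (u1 R) (u2 R)).toLp (cftI (u R))
  set κ : ℝ := √((2 * Real.pi) ^ n) with hκ
  have hκ0 : 0 < κ := Real.sqrt_pos.2 (by positivity)
  have hdist : ∀ R S, dist (V R) (V S) = κ * dist (U R) (U S) := fun R S => by
    have e : eLpNorm (cftI (u R) - cftI (u S)) 2 =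
        ENNReal.ofReal κ * eLpNorm (u R - u S) 2 := by
      rw [← cftI_sub hn (u1 R) (u1 S), eLpNorm_cftI hn ((u1 R).sub (u1 S)) ((u2 R).sub (u2 S))]
    rw [dist_eq_norm, dist_eq_norm, ← MemLp.toLp_sub, ← MemLp.toLp_sub, Lp.norm_toLp,
      Lp.norm_toLp, e, ENNReal.toReal_mul, ENNReal.toReal_ofReal hκ0.le]
  have hU : Cauchy (map U atTop) := by
    refine Tendsto.cauchy_map (l := atTop) (a := hf.toLp f) ?_
    exact (Lp.tendsto_Lp_iff_tendsto_eLpNorm'' u u2 f hf).2 (tendsto_indicator_ball hf)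
  have hV : Cauchy (map V atTop) := by
    rw [Metric.cauchy_iff] at hU ⊢
    refine ⟨inferInstance, fun ε hε => ?_⟩
    obtain ⟨t, ht, h⟩ := hU.2 (ε / κ) (by positivity)
    refine ⟨V '' (U ⁻¹' t), image_mem_map ht, ?_⟩
    rintro _ ⟨R, hR, rfl⟩ _ ⟨S, hS, rfl⟩
    rw [hdist, mul_comm]
    exact (lt_div_iff₀ hκ0).1 (h _ hR _ hS)
  obtain ⟨F, hF⟩ := CompleteSpace.complete hV
  refine ⟨F, isL2_iff.2 (Lp.memLp F), ?_⟩
  simp only [normSqL2_sub_cftIntegral hn hf F]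
  have h3 : Tendsto V atTop (𝓝 ((Lp.memLp F).toLp F)) := by rw [Lp.toLp_coeFn]; exact hF
  have h4 := (Lp.tendsto_Lp_iff_tendsto_eLpNorm'' (fun R => cftI (u R))
    (fun R => memLp_cftI hn (u1 R) (u2 R)) F (Lp.memLp F)).1 h3
  have h5 := (ENNReal.continuous_pow 2).tendsto 0 |>.comp h4
  rwa [zero_pow two_ne_zero] at h5

lemma isL2CFT_cft (hf : MemLp f 2) : IsL2CFT f (cft f) :=
  IsCFT.isL2CFT hn hf (Classical.epsilon_spec (exists_isCFT hn hf))

end Existence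

/-! ### Similitudes -/

/-- A rotation as a linear isometry. -/
def rotE (r : SO n) : E n ≃ₗᵢ[ℝ] E n where
  toFun := rot r
  map_add' x y := by ext i; simp [rot, Matrix.mulVec_add]
  map_smul' c x := by ext i; simp [rot, Matrix.mulVec_smul]
  invFun := rot r⁻¹
  left_inv x := by
    have : (r⁻¹ * r : SO n).1 = 1 := by rw [inv_mul_cancel]; rfl
    have h2 : (r⁻¹ : SO n).1 * r.1 = 1 := this
    simp [rot, Matrix.mulVec_mulVec, h2]
  right_inv x := by
    have : (r * r⁻¹ : SO n).1 = 1 := by rw [mul_inv_cancel]; rfl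
    have h2 : r.1 * (r⁻¹ : SO n).1 = 1 := this
    simp [rot, Matrix.mulVec_mulVec, h2]
  norm_map' x := by
    change ‖rot r x‖ = ‖x‖
    have h1 : r.1.transpose * r.1 = 1 := by
      have h := r.2
      rw [Matrix.mem_specialOrthogonalGroup_iff] at h
      exact (Matrix.mem_orthogonalGroup_iff' (Fin n) ℝ).1 h.1
    have h2 : ∀ y : E n, ‖y‖ ^ 2 = y.ofLp ⬝ᵥ y.ofLp := fun y => by
      rw [EuclideanSpace.norm_sq_eq]; simp [dotProduct, sq]
    rw [← sq_eq_sq₀ (norm_nonneg _) (norm_nonneg _), h2, h2]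
    simp only [rot]
    rw [Matrix.dotProduct_mulVec, Matrix.vecMul_mulVec, h1, Matrix.vecMul_one]

@[simp] lemma rotE_apply (r : SO n) (x : E n) : rotE r x = rot r x := rfl

@[simp] lemma rotE_symm_apply (r : SO n) (x : E n) : (rotE r).symm x = rot r⁻¹ x := rfl

section Similitude

variable {a : ℝ} (ha : 0 < a) (r : SO n) (b : E n)
include ha

lemma lintegral_comp_smul_rot (g : E n → ℝ≥0∞) :
    ∫⁻ x, g (a • rot r⁻¹ x) = ENNReal.ofReal (a ^ n)⁻¹ * ∫⁻ x, g x := by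
  have h := (rotE r).symm.measurePreserving.lintegral_comp_emb
    (rotE r).symm.toHomeomorph.measurableEmbedding (fun x => g (a • x))
  simp only [rotE_symm_apply] at h
  rw [h, lintegral_comp_smul g ha.ne', abs_of_pos (by positivity)]

lemma lintegral_comp_daughter (g : E n → ℝ≥0∞) :
    ∫⁻ x, g (rot r⁻¹ (a⁻¹ • (x - b))) = ENNReal.ofReal (a ^ n) * ∫⁻ x, g x := by
  rw [lintegral_sub_right_eq_self (fun x => g (rot r⁻¹ (a⁻¹ • x))) b,
    lintegral_comp_smul (fun x => g (rot r⁻¹ x)) (inv_ne_zero ha.ne'), inv_pow, inv_inv,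
    abs_of_pos (by positivity)]
  congr 1
  exact (rotE r).symm.measurePreserving.lintegral_comp_emb
    (rotE r).symm.toHomeomorph.measurableEmbedding g

omit ha in
lemma quasiMeasurePreserving_smul {c : ℝ} (hc : c ≠ 0) :
    Measure.QuasiMeasurePreserving (fun x : E n => c • x) := by
  refine ⟨measurable_const_smul c, ?_⟩
  rw [Measure.map_addHaar_smul _ hc]
  exact Measure.smul_absolutelyContinuous

lemma quasiMeasurePreserving_smul_rot :
    Measure.QuasiMeasurePreserving (fun x : E n => a • rot r⁻¹ x) :=
  (quasiMeasurePreserving_smul ha.ne').comp (rotE r).symm.measurePreserving.quasiMeasurePreserving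

lemma quasiMeasurePreserving_daughter :
    Measure.QuasiMeasurePreserving (fun x : E n => rot r⁻¹ (a⁻¹ • (x - b))) :=
  (rotE r).symm.measurePreserving.quasiMeasurePreserving.comp
    ((quasiMeasurePreserving_smul (inv_ne_zero ha.ne')).comp
      (measurePreserving_sub_right volume b).quasiMeasurePreserving)

lemma eLpNorm_comp_smul_rot (w : E n → Cl n) :
    eLpNorm (fun x => w (a • rot r⁻¹ x)) 2 =
      ENNReal.ofReal (√(a ^ n)⁻¹) * eLpNorm w 2 := by
  have h := lintegral_comp_smul_rot ha r (fun x => ‖w x‖ₑ ^ 2)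
  rw [← eLpNorm_two_sq _ w, ← eLpNorm_two_sq _ (fun x => w (a • rot r⁻¹ x)),
    ← Real.sq_sqrt (show 0 ≤ (a ^ n)⁻¹ by positivity),
    ENNReal.ofReal_pow (Real.sqrt_nonneg _), ← mul_pow] at h
  exact (ENNReal.pow_right_strictMono two_ne_zero).injective h

lemma eLpNorm_comp_daughter (w : E n → Cl n) :
    eLpNorm (fun x => w (rot r⁻¹ (a⁻¹ • (x - b)))) 2 =
      ENNReal.ofReal (√(a ^ n)) * eLpNorm w 2 := by
  have h := lintegral_comp_daughter ha r b (fun x => ‖w x‖ₑ ^ 2)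
  rw [← eLpNorm_two_sq _ w, ← eLpNorm_two_sq _ (fun x => w (rot r⁻¹ (a⁻¹ • (x - b)))),
    ← Real.sq_sqrt (show 0 ≤ a ^ n by positivity),
    ENNReal.ofReal_pow (Real.sqrt_nonneg _), ← mul_pow] at h
  exact (ENNReal.pow_right_strictMono two_ne_zero).injective h

lemma integral_comp_daughter (w : E n → Cl n) :
    ∫ x, w (rot r⁻¹ (a⁻¹ • (x - b))) = a ^ n • ∫ x, w x := by
  rw [integral_sub_right_eq_self (fun x => w (rot r⁻¹ (a⁻¹ • x))) b,
    Measure.integral_comp_smul volume (fun x => w (rot r⁻¹ x)) a⁻¹]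
  congr 1
  · rw [finrank_euclideanSpace, Fintype.card_fin, inv_pow, inv_inv, abs_of_pos (by positivity)]
  · exact (rotE r).symm.measurePreserving.integral_comp
      (rotE r).symm.toHomeomorph.measurableEmbedding w

lemma memLp_comp_daughter {w : E n → Cl n} (hw : MemLp w 2) :
    MemLp (fun x => w (rot r⁻¹ (a⁻¹ • (x - b)))) 2 := by
  refine ⟨hw.1.comp_quasiMeasurePreserving (quasiMeasurePreserving_daughter ha r b), ?_⟩
  rw [eLpNorm_comp_daughter ha]
  exact ENNReal.mul_lt_top ENNReal.ofReal_lt_top hw.2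

lemma memLp_comp_smul_rot {w : E n → Cl n} (hw : MemLp w 2) :
    MemLp (fun x => w (a • rot r⁻¹ x)) 2 := by
  refine ⟨hw.1.comp_quasiMeasurePreserving (quasiMeasurePreserving_smul_rot ha r), ?_⟩
  rw [eLpNorm_comp_smul_rot ha]
  exact ENNReal.mul_lt_top ENNReal.ofReal_lt_top hw.2

lemma integrable_comp_daughter {w : E n → Cl n} (hw : Integrable w) :
    Integrable (fun x => w (rot r⁻¹ (a⁻¹ • (x - b)))) := by
  refine ⟨hw.1.comp_quasiMeasurePreserving (quasiMeasurePreserving_daughter ha r b), ?_⟩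
  rw [HasFiniteIntegral, lintegral_comp_daughter ha r b (fun x => ‖w x‖ₑ)]
  exact ENNReal.mul_lt_top ENNReal.ofReal_lt_top hw.2

/-- Substitute $x=a\,ry+b$; the rotation moves to $\omega$ as its inverse. -/
lemma cftI_comp_daughter (hn : n % 4 = 2 ∨ n % 4 = 3) {u : E n → Cl n} (hu : Integrable u)
    (ω : E n) : cftI (fun x => u (rot r⁻¹ (a⁻¹ • (x - b)))) ω =
      a ^ n • (cftI u (a • rot r⁻¹ ω) * expI (-inner ℝ ω b)) := by
  have h := integral_comp_daughter ha r b
    (fun y => u y * expI (-inner ℝ ω (a • rot r y + b)))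
  have hinv : ∀ x : E n, a • rot r (rot r⁻¹ (a⁻¹ • (x - b))) + b = x := fun x => by
    rw [← rotE_symm_apply, ← rotE_apply, LinearIsometryEquiv.apply_symm_apply,
      smul_inv_smul₀ ha.ne', sub_add_cancel]
  have hin : ∀ y : E n, -inner ℝ ω (a • rot r y + b) =
      -inner ℝ (a • rot r⁻¹ ω) y + -inner ℝ ω b := fun y => by
    have : inner ℝ ω (rot r y) = inner ℝ (rot r⁻¹ ω) y := by
      rw [← rotE_symm_apply, ← rotE_apply, ← (rotE r).inner_map_map ((rotE r).symm ω) y,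
        LinearIsometryEquiv.apply_symm_apply]
    rw [inner_add_right, inner_smul_right, inner_smul_left, this]
    simp only [conj_trivial]; ring
  simp only [hinv] at h
  rw [cftI, h]
  congr 1
  simp only [hin, expI_add hn, ← mul_assoc]
  exact ((mulL.flip (expI (-inner ℝ ω b))).integral_comp_comm
    (integrable_mul_expI hn hu _ (by fun_prop)))

lemma IsL2CFT.comp_daughter (hn : n % 4 = 2 ∨ n % 4 = 3) {f F : E n → Cl n} (h : IsL2CFT f F) :
    IsL2CFT (fun x => f (rot r⁻¹ (a⁻¹ • (x - b))))
      (fun ω => a ^ n • (F (a • rot r⁻¹ ω) * expI (-inner ℝ ω b))) := by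
  obtain ⟨u, u1, u2, u3, u4⟩ := h.exists_seq
  refine ⟨memLp_comp_daughter ha r b h.memLp,
    (memLp_mul_expI hn (memLp_comp_smul_rot ha r h.memLp') (fun ω => -inner ℝ ω b)
      (by fun_prop)).const_smul (a ^ n),
    fun k x => u k (rot r⁻¹ (a⁻¹ • (x - b))), fun k => integrable_comp_daughter ha r b (u1 k),
    fun k => memLp_comp_daughter ha r b (u2 k), ?_, ?_⟩
  · have e : ∀ k, eLpNorm ((fun x => u k (rot r⁻¹ (a⁻¹ • (x - b)))) -
        fun x => f (rot r⁻¹ (a⁻¹ • (x - b)))) 2 =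
        ENNReal.ofReal (√(a ^ n)) * eLpNorm (u k - f) 2 :=
      fun k => eLpNorm_comp_daughter ha r b (u k - f)
    simp only [e]
    simpa using ENNReal.Tendsto.const_mul u3 (Or.inr (ENNReal.ofReal_ne_top (r := √(a ^ n))))
  · have e : ∀ k, eLpNorm (cftI (fun x => u k (rot r⁻¹ (a⁻¹ • (x - b)))) -
        fun ω => a ^ n • (F (a • rot r⁻¹ ω) * expI (-inner ℝ ω b))) 2 =
        ‖a ^ n‖ₑ * (ENNReal.ofReal (√(a ^ n)⁻¹) * eLpNorm (cftI (u k) - F) 2) := fun k => by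
      rw [← eLpNorm_comp_smul_rot ha r, ← eLpNorm_const_smul]
      refine eLpNorm_congr_norm_ae (Eventually.of_forall fun ω => ?_)
      simp only [Pi.sub_apply, Pi.smul_apply]
      rw [cftI_comp_daughter ha r b hn (u1 k), ← smul_sub, ← sub_mul, norm_smul, norm_smul,
        norm_mul_expI hn]
    simp only [e]
    have := ENNReal.Tendsto.const_mul (ENNReal.Tendsto.const_mul u4
      (Or.inr (ENNReal.ofReal_ne_top (r := √(a ^ n)⁻¹)))) (Or.inr (enorm_ne_top (x := a ^ n)))
    simpa using this

/-- The wavelet transform on the Fourier side. -/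
lemma waveletTransform_eq (hn : n % 4 = 2 ∨ n % 4 = 3) {f F ψ Ψ : E n → Cl n}
    (hf : IsL2CFT f F) (hψ : IsL2CFT ψ Ψ) :
    (2 * Real.pi) ^ n • waveletTransform ψ f ((a, r), b) =
      ∫ ω, F ω * expI (inner ℝ ω b) * rev (a ^ ((n : ℝ) / 2) • Ψ (a • rot r⁻¹ ω)) := by
  have hd := (hψ.comp_daughter ha r b hn).clm hn
    ((a ^ ((n : ℝ) / 2))⁻¹ • ContinuousLinearMap.id ℝ (Cl n)) (fun M t => by simp)
  have hm : MemLp (daughter ψ ((a, r), b)) 2 := hd.memLp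
  have e := hf.integral_mul_rev hn hd
  rw [waveletTransform, innerCl_eq hf.memLp hm]
  refine e.symm.trans (integral_congr_ae (Eventually.of_forall fun ω => ?_))
  -- The normalization $a^{-n/2}$ of the daughter meets the Jacobian $a^n$.
  have ha2 : (a ^ ((n : ℝ) / 2))⁻¹ * a ^ n = a ^ ((n : ℝ) / 2) := by
    have h1 : a ^ n = a ^ ((n : ℝ) / 2) * a ^ ((n : ℝ) / 2) := by
      rw [← Real.rpow_add ha, add_halves, Real.rpow_natCast]
    have : a ^ ((n : ℝ) / 2) ≠ 0 := (Real.rpow_pos_of_pos ha _).ne'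
    rw [h1]; field_simp
  simp only [_root_.smul_apply, ContinuousLinearMap.id_apply, smul_smul, ha2,
    rev_smul, rev_mul, rev_expI hn, neg_neg, mul_smul_comm, mul_assoc]

end Similitude

/-! ### The uncertainty inequality by translations -/

/-- Discrete commutator argument: $a$ is a function, $a'$ its translate, and $c,c'$ their products
with the coordinate. The two inner product identities combine to $t|a|^2=\langle c+c',a-a'\rangle$;
Cauchy–Schwarz then leaves a factor $t$ to cancel. -/
lemma norm_sq_le_of_almost_commuting {V : Type*} [NormedAddCommGroup V] [InnerProductSpace ℝ V]
    {a a' c c' : V} {t κ : ℝ} (ht : 0 < t) (n2 : ‖c'‖ ≤ ‖c‖ + t * ‖a‖)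
    (n3 : ‖a - a'‖ ≤ t * κ) (i1 : inner ℝ c a' = inner ℝ c' a)
    (i2 : inner ℝ c' a' + t * ‖a‖ ^ 2 = inner ℝ c a) : ‖a‖ ^ 2 ≤ (2 * ‖c‖ + t * ‖a‖) * κ := by
  have i3 : t * ‖a‖ ^ 2 = inner ℝ (c + c') (a - a') := by
    rw [inner_add_left, inner_sub_right, inner_sub_right, i1]; linarith
  have i4 : t * ‖a‖ ^ 2 ≤ (‖c‖ + (‖c‖ + t * ‖a‖)) * (t * κ) := by
    rw [i3]
    refine (real_inner_le_norm _ _).trans ?_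
    gcongr
    exact (norm_add_le _ _).trans (by gcongr)
  refine le_of_mul_le_mul_left (i4.trans (le_of_eq ?_)) ht
  ring

section Translation

variable {S : Type*} [MeasurableSpace S] {m : Measure S}

lemma inner_toLp {u v : S → ℝ} (hu : MemLp u 2 m) (hv : MemLp v 2 m) :
    inner ℝ (hu.toLp u) (hv.toLp v) = ∫ s, u s * v s ∂m := by
  rw [L2.inner_def]
  refine integral_congr_ae ?_
  filter_upwards [hu.coeFn_toLp, hv.coeFn_toLp] with s h1 h2
  rw [h1, h2]
  simp [mul_comm]

lemma norm_sq_le_of_translation_of_pos {N ξ : S → ℝ} (hN : MemLp N 2 m) (hξ : MemLp (ξ * N) 2 m)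
    {τ : S → S} (hτ : MeasurePreserving τ m m) {t : ℝ} (ht : 0 < t)
    (hξτ : ∀ s, ξ (τ s) = ξ s + t) {κ : ℝ} (hκ : 0 ≤ κ)
    (hD : eLpNorm (N - N ∘ τ) 2 m ≤ ENNReal.ofReal (t * κ)) :
    ‖hN.toLp N‖ ^ 2 ≤ (2 * ‖hξ.toLp (ξ * N)‖ + t * ‖hN.toLp N‖) * κ := by
  have hNt : MemLp (N ∘ τ) 2 m := hN.comp_measurePreserving hτ
  have hct' : MemLp ((ξ * N) ∘ τ) 2 m := hξ.comp_measurePreserving hτ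
  -- This identity shows $\xi\,(N\circ\tau)\in L^2$, bounds its norm, and produces the term
  -- $t\|N\|^2$ once $\tau$-invariance is used.
  have ef : (ξ * N) ∘ τ = ξ * (N ∘ τ) + t • (N ∘ τ) := by
    ext s; simp [hξτ]; ring
  have hct : MemLp (ξ * (N ∘ τ)) 2 m := by
    have := hct'.sub (hNt.const_smul t)
    rwa [ef, add_sub_cancel_right] at this
  have n1 : ‖hNt.toLp (N ∘ τ)‖ = ‖hN.toLp N‖ := by
    rw [Lp.norm_toLp, Lp.norm_toLp, eLpNorm_comp_measurePreserving hN.1 hτ]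
  have n1' : ‖hct'.toLp ((ξ * N) ∘ τ)‖ = ‖hξ.toLp (ξ * N)‖ := by
    rw [Lp.norm_toLp, Lp.norm_toLp, eLpNorm_comp_measurePreserving hξ.1 hτ]
  have e : hct'.toLp ((ξ * N) ∘ τ) =
      hct.toLp (ξ * (N ∘ τ)) + t • hNt.toLp (N ∘ τ) := by
    rw [← MemLp.toLp_const_smul, ← MemLp.toLp_add]
    exact MemLp.toLp_congr _ _ (Eventually.of_forall fun s => congrFun ef s)
  refine norm_sq_le_of_almost_commuting (a' := hNt.toLp (N ∘ τ))
    (c' := hct.toLp (ξ * (N ∘ τ))) ht ?_ ?_ ?_ ?_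
  · rw [eq_sub_of_add_eq e.symm]
    refine (norm_sub_le _ _).trans ?_
    rw [n1', norm_smul, n1, Real.norm_of_nonneg ht.le]
  · rw [← MemLp.toLp_sub, Lp.norm_toLp]
    exact ENNReal.toReal_le_of_le_ofReal (by positivity) hD
  · rw [inner_toLp, inner_toLp]
    exact integral_congr_ae (Eventually.of_forall fun s => by
      simp only [Pi.mul_apply, Function.comp_apply]; ring)
  · have e1 : inner ℝ (hct'.toLp ((ξ * N) ∘ τ)) (hNt.toLp (N ∘ τ)) =
        inner ℝ (hξ.toLp (ξ * N)) (hN.toLp N) := by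
      rw [inner_toLp, inner_toLp]
      have hm : AEStronglyMeasurable (fun s => (ξ * N) s * N s) (m.map τ) := by
        rw [hτ.map_eq]; exact hξ.1.mul hN.1
      have := integral_map hτ.aemeasurable hm
      rw [hτ.map_eq] at this
      exact this.symm
    rw [← e1, e, inner_add_left, real_inner_smul_left, real_inner_self_eq_norm_sq, n1]

/-- If translating `H` along a flow `τ` on which the function `ξ` increases at unit speed is
Lipschitz in `L²`, the `L²` norm of `H` is controlled by that of `ξ H`. -/
lemma uncertainty_of_translation {W : Type*} [NormedAddCommGroup W] {H : S → W} (hH : MemLp H 2 m)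
    {ξ : S → ℝ} (hξ : MemLp (fun s => ξ s * ‖H s‖) 2 m) (τ : ℝ → S → S)
    (hτ : ∀ t, MeasurePreserving (τ t) m m) (hξτ : ∀ t s, ξ (τ t s) = ξ s + t) {κ : ℝ}
    (hκ : 0 ≤ κ)
    (hD : ∀ t > 0, eLpNorm (fun s => H (τ t s) - H s) 2 m ≤ ENNReal.ofReal (t * κ)) :
    (eLpNorm H 2 m).toReal ^ 2 ≤ 2 * κ * (eLpNorm (fun s => ξ s * ‖H s‖) 2 m).toReal := by
  have hN : MemLp (fun s => ‖H s‖) 2 m := hH.norm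
  have key : ∀ t > 0, ‖hN.toLp _‖ ^ 2 ≤ (2 * ‖hξ.toLp _‖ + t * ‖hN.toLp _‖) * κ := fun t ht => by
    refine norm_sq_le_of_translation_of_pos hN hξ (hτ t) ht (hξτ t) hκ (le_trans ?_ (hD t ht))
    refine eLpNorm_mono fun s => ?_
    simp only [Pi.sub_apply, Function.comp_apply, Real.norm_eq_abs]
    rw [abs_sub_comm]
    exact abs_norm_sub_norm_le _ _
  rw [Lp.norm_toLp, Lp.norm_toLp, eLpNorm_norm] at key
  set z := (eLpNorm H 2 m).toReal
  set y := (eLpNorm (fun s => ξ s * ‖H s‖) 2 m).toReal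
  -- The error term $tz\kappa$ disappears as $t\downarrow0$.
  have lim : Tendsto (fun t : ℝ => (2 * y + t * z) * κ) (𝓝[>] 0)
      (𝓝 ((2 * y + 0 * z) * κ)) :=
    ((Continuous.tendsto (by fun_prop) 0).mono_left nhdsWithin_le_nhds)
  have := ge_of_tendsto lim (eventually_nhdsWithin_of_forall key)
  linarith

/-- The previous inequality in terms of lower integrals. -/
lemma lintegral_sq_le_of_translation {W : Type*} [NormedAddCommGroup W] {H : S → W}
    (hH : AEStronglyMeasurable H m) {ξ : S → ℝ} (hξ : AEStronglyMeasurable ξ m) (τ : ℝ → S → S)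
    (hτ : ∀ t, MeasurePreserving (τ t) m m) (hξτ : ∀ t s, ξ (τ t s) = ξ s + t) {K : ℝ≥0∞}
    (hZ : ∫⁻ s, ‖H s‖ₑ ^ 2 ∂m ≠ ⊤) (hY : ∫⁻ s, ENNReal.ofReal (ξ s ^ 2) * ‖H s‖ₑ ^ 2 ∂m ≠ ⊤)
    (hK : K ≠ ⊤)
    (hD : ∀ t > 0, ∫⁻ s, ‖H (τ t s) - H s‖ₑ ^ 2 ∂m ≤ ENNReal.ofReal (t ^ 2) * K) :
    (∫⁻ s, ‖H s‖ₑ ^ 2 ∂m) ^ 2 ≤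
      4 * K * ∫⁻ s, ENNReal.ofReal (ξ s ^ 2) * ‖H s‖ₑ ^ 2 ∂m := by
  have eY : ∫⁻ s, ENNReal.ofReal (ξ s ^ 2) * ‖H s‖ₑ ^ 2 ∂m =
      eLpNorm (fun s => ξ s * ‖H s‖) 2 m ^ 2 := by
    rw [eLpNorm_two_sq]
    refine lintegral_congr fun s => ?_
    rw [enorm_mul, mul_pow, enorm_norm, Real.enorm_eq_ofReal_abs,
      ← ENNReal.ofReal_pow (abs_nonneg _), sq_abs]
  rw [eY] at hY ⊢
  rw [← eLpNorm_two_sq] at hZ ⊢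
  have hZ' : eLpNorm H 2 m ≠ ⊤ := fun h => hZ (by simp [h])
  have hY' : eLpNorm (fun s => ξ s * ‖H s‖) 2 m ≠ ⊤ := fun h => hY (by simp [h])
  have h := uncertainty_of_translation ⟨hH, hZ'.lt_top⟩ ⟨hξ.mul hH.norm, hY'.lt_top⟩ τ hτ hξτ
    (κ := √K.toReal) (Real.sqrt_nonneg _) fun t ht => by
      rw [← (ENNReal.pow_right_strictMono two_ne_zero).le_iff_le, eLpNorm_two_sq]
      refine (hD t ht).trans (le_of_eq ?_)
      rw [ENNReal.ofReal_mul ht.le, mul_pow, ENNReal.ofReal_pow ht.le,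
        ← ENNReal.ofReal_pow (Real.sqrt_nonneg _), Real.sq_sqrt ENNReal.toReal_nonneg,
        ENNReal.ofReal_toReal hK]
  have h2 := pow_le_pow_left₀ (by positivity) h 2
  rw [← ENNReal.toReal_le_toReal (ENNReal.pow_ne_top hZ)
    (ENNReal.mul_ne_top (ENNReal.mul_ne_top (by simp) hK) hY)]
  simp only [ENNReal.toReal_mul, ENNReal.toReal_pow, ENNReal.toReal_ofNat]
  refine h2.trans (le_of_eq ?_)
  rw [mul_pow, mul_pow, Real.sq_sqrt ENNReal.toReal_nonneg]
  norm_num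

end Translation

/-! ### Translation estimates from the Fourier side -/

section FourierTranslation

variable (hn : n % 4 = 2 ∨ n % 4 = 3) {h : E n → Cl n} (h1 : Integrable h) (h2 : MemLp h 2)
include hn h1

lemma cftI_translate (v b : E n) :
    cftI (fun ω => h (ω + v)) b = cftI h b * expI (inner ℝ b v) := by
  have e := integral_add_right_eq_self (μ := volume) (fun ω => h ω * expI (-inner ℝ b (ω - v))) v
  simp only [add_sub_cancel_right] at e
  rw [cftI, e]
  have hin : ∀ ω : E n, -inner ℝ b (ω - v) = -inner ℝ b ω + inner ℝ b v := fun ω => by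
    rw [inner_sub_right]; ring
  simp only [hin, expI_add hn, ← mul_assoc]
  exact ((mulL.flip (expI (inner ℝ b v))).integral_comp_comm
    (integrable_mul_expI hn h1 _ (by fun_prop)))

include h2

/-- Translation by $te_k$ multiplies the transform by $e^{i_ntb_k}$; combine Plancherel with
$|e^{i_ns}-1|\le|s|$. -/
lemma lintegral_translate_sub_sq_le (k : Fin n) (t : ℝ) :
    ENNReal.ofReal ((2 * Real.pi) ^ n) *
        ∫⁻ ω, ‖h (ω + t • EuclideanSpace.single k (1 : ℝ)) - h ω‖ₑ ^ 2 ≤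
      ENNReal.ofReal (t ^ 2) * ∫⁻ b, ENNReal.ofReal (b k ^ 2) * ‖cftI h b‖ₑ ^ 2 := by
  set v : E n := t • EuclideanSpace.single k (1 : ℝ) with hv
  have a1 : Integrable (fun ω => h (ω + v)) := h1.comp_add_right v
  have a2 : MemLp (fun ω => h (ω + v)) 2 :=
    h2.comp_measurePreserving (measurePreserving_add_right volume v)
  have e := lintegral_cftI_sq hn (a1.sub h1) (a2.sub h2)
  simp only [Pi.sub_apply] at e
  rw [← e, cftI_sub hn a1 h1, ← lintegral_const_mul' _ _ ENNReal.ofReal_ne_top]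
  refine lintegral_mono fun b => ?_
  rw [Pi.sub_apply, cftI_translate hn h1]
  have hb : inner ℝ b v = t * b k := by
    rw [hv, inner_smul_right, EuclideanSpace.inner_single_right]; simp
  have := norm_mul_expI_sub_le (cftI h b) (inner ℝ b v) hn
  rw [← ofReal_norm, ← ofReal_norm, ← ENNReal.ofReal_pow (norm_nonneg _),
    ← ENNReal.ofReal_pow (norm_nonneg _), ← ENNReal.ofReal_mul (by positivity),
    ← ENNReal.ofReal_mul (by positivity)]
  refine ENNReal.ofReal_le_ofReal ?_
  refine (pow_le_pow_left₀ (norm_nonneg _) this 2).trans (le_of_eq ?_)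
  rw [mul_pow, sq_abs, hb]; ring

end FourierTranslation

/-! ### The rotation group and the measures -/

lemma isClosed_specialOrthogonalGroup :
    IsClosed (Matrix.specialOrthogonalGroup (Fin n) ℝ : Set (Matrix (Fin n) (Fin n) ℝ)) := by
  have : (Matrix.specialOrthogonalGroup (Fin n) ℝ : Set (Matrix (Fin n) (Fin n) ℝ)) =
      {M | M * star M = 1} ∩ {M | M.det = 1} := by
    ext M
    rw [SetLike.mem_coe, Matrix.mem_specialOrthogonalGroup_iff, Matrix.mem_orthogonalGroup_iff]
    exact Iff.rfl
  rw [this]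
  exact (isClosed_eq (by fun_prop) continuous_const).inter
    (isClosed_eq (by fun_prop) continuous_const)

instance : SecondCountableTopology (Matrix (Fin n) (Fin n) ℝ) :=
  inferInstanceAs (SecondCountableTopology (Fin n → Fin n → ℝ))

instance : SigmaCompactSpace (Matrix (Fin n) (Fin n) ℝ) :=
  inferInstanceAs (SigmaCompactSpace (Fin n → Fin n → ℝ))

/-- Second countability makes continuous maps on products with $SO(n)$ measurable for the product
$\sigma$-algebra. -/
instance : SecondCountableTopology (SO n) :=
  Topology.IsInducing.subtypeVal.secondCountableTopology

instance : SigmaCompactSpace (SO n) :=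
  isClosed_specialOrthogonalGroup.isClosedEmbedding_subtypeVal.sigmaCompactSpace

lemma rot_inv_apply (r : SO n) (x : E n) (i : Fin n) : rot r⁻¹ x i = ∑ j, r.1 j i * x j := rfl

@[fun_prop] lemma continuous_rot_inv : Continuous fun q : SO n × E n => rot q.1⁻¹ q.2 := by
  refine (PiLp.continuous_toLp 2 _).comp (continuous_pi fun i => ?_)
  change Continuous fun q : SO n × E n => rot q.1⁻¹ q.2 i
  simp only [rot_inv_apply]
  refine continuous_finsetSum _ fun j _ => Continuous.mul ?_ (by fun_prop)
  have h : Continuous fun r : SO n => r.1 j i := continuous_subtype_val.matrix_elem j i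
  exact h.comp continuous_fst

/-- The action `(p, ω) ↦ a r⁻¹ ω` is continuous, hence measurable. -/
lemma measurable_dilRot : Measurable fun q : (ℝ × SO n) × E n => q.1.1 • rot q.1.2⁻¹ q.2 := by
  refine Continuous.measurable ?_
  exact (continuous_fst.comp continuous_fst).smul
    (continuous_rot_inv.comp ((continuous_snd.comp continuous_fst).prodMk continuous_snd))

section Measures

variable (ν : Measure (SO n))

instance [SigmaFinite ν] : SFinite (dilRotMeasure ν) := by unfold dilRotMeasure; infer_instance

lemma ae_dilRotMeasure_pos : ∀ᵐ p ∂dilRotMeasure ν, 0 < p.1 := by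
  unfold dilRotMeasure
  refine Measure.quasiMeasurePreserving_fst.ae (p := fun a => 0 < a) ?_
  exact (withDensity_absolutelyContinuous _ _).ae_le (ae_restrict_mem measurableSet_Ioi)

/-- Almost every point of almost every orbit of the similitudes avoids a given null set. -/
lemma ae_ae_dilRot [SigmaFinite ν] {P : E n → Prop} (hP : ∀ᵐ x, P x) :
    ∀ᵐ ω : E n, ∀ᵐ p ∂dilRotMeasure ν, P (p.1 • rot p.2⁻¹ ω) := by
  -- The exceptional set is enlarged to a measurable null set so that the two "almost every"
  -- quantifiers can be exchanged.
  obtain ⟨t, ht, htm, ht0⟩ := exists_measurable_superset_of_null (ae_iff.1 hP)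
  have hm : MeasurableSet {q : (ℝ × SO n) × E n | q.1.1 • rot q.1.2⁻¹ q.2 ∉ t} :=
    measurable_dilRot htm.compl
  have h : ∀ᵐ p ∂dilRotMeasure ν, ∀ᵐ ω : E n, p.1 • rot p.2⁻¹ ω ∉ t := by
    filter_upwards [ae_dilRotMeasure_pos ν] with p hp
    exact (quasiMeasurePreserving_smul_rot hp p.2).ae (compl_mem_ae_iff.2 ht0)
  filter_upwards [(Measure.ae_ae_comm hm).1 h] with ω hω
  filter_upwards [hω] with p hp
  by_contra hc
  exact hp (ht hc)

end Measures

/-! ### Parity and the admissibility constant -/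

/-- Grade involution as a continuous linear map. -/
def involuteL : Cl n →L[ℝ] Cl n :=
  LinearMap.toContinuousLinearMap CliffordAlgebra.involute.toLinearMap

@[simp] lemma involuteL_apply (M : Cl n) : involuteL M = CliffordAlgebra.involute M := rfl

lemma involute_expI (hn : Even n) (t : ℝ) :
    CliffordAlgebra.involute (expI t : Cl n) = expI t := by
  simp [expI, involute_pseudo hn]

lemma pseudo_mul_of_involute_eq (h0 : n ≠ 0) (hn : Even n) {M : Cl n} {ε : ℝ}
    (hε : ε = 1 ∨ ε = -1) (h : CliffordAlgebra.involute M = ε • M) :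
    pseudo n * M = ε • (M * pseudo n) := by
  rw [mul_pseudo_of_even h0 hn, h, mul_smul_comm, smul_smul]
  rcases hε with rfl | rfl <;> simp

/-- The Fourier transform of a wavelet commutes with the pseudoscalar up to a sign. -/
lemma exists_parity_sign (hn : n % 4 = 2 ∨ n % 4 = 3) {ψ Ψ : E n → Cl n} (h : IsL2CFT ψ Ψ)
    (hpar : n % 4 = 2 → HasParity ψ) :
    ∃ ε : ℝ, (ε = 1 ∨ ε = -1) ∧ ∀ᵐ ω, pseudo n * Ψ ω = ε • (Ψ ω * pseudo n) := by
  by_cases h2 : n % 4 = 2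
  · have he : Even n := Nat.even_iff.2 (by omega)
    have h0 : n ≠ 0 := by rintro rfl; simp at h2
    have key : ∀ ε : ℝ, (ε = 1 ∨ ε = -1) → (∀ᵐ x, CliffordAlgebra.involute (ψ x) = ε • ψ x) →
        ∃ ε : ℝ, (ε = 1 ∨ ε = -1) ∧ ∀ᵐ ω, pseudo n * Ψ ω = ε • (Ψ ω * pseudo n) := by
      intro ε hε hψ
      refine ⟨ε, hε, ?_⟩
      -- For even $n$ the exponentials are even, so the transform preserves parity: the involute of
      -- $\Psi$ and $\varepsilon\Psi$ transform almost everywhere equal functions.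
      have e := (h.clm hn involuteL fun M t => by simp [involute_expI he]).unique hn
        (h.clm hn (ε • ContinuousLinearMap.id ℝ (Cl n)) fun M t => by simp) hψ
      filter_upwards [e] with ω hω
      exact pseudo_mul_of_involute_eq h0 he hε hω
    rcases hpar h2 with hp | hp
    · exact key 1 (Or.inl rfl) (hp.mono fun x hx => by
        rw [one_smul]; exact CliffordAlgebra.involute_eq_of_mem_even hx)
    · exact key (-1) (Or.inr rfl) (hp.mono fun x hx => by
        rw [neg_one_smul]; exact CliffordAlgebra.involute_eq_of_mem_odd hx)
  · refine ⟨1, Or.inl rfl, Eventually.of_forall fun ω => ?_⟩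
    rw [one_smul, mul_pseudo_of_odd (Nat.odd_iff.2 (by omega))]

lemma expI_mul_of_pseudo_mul {M : Cl n} {ε : ℝ} (hε : ε = 1 ∨ ε = -1)
    (h : pseudo n * M = ε • (M * pseudo n)) (t : ℝ) : expI t * M = M * expI (ε * t) := by
  simp only [expI, add_mul, mul_add, smul_mul_assoc, mul_smul_comm, one_mul, mul_one, h]
  rcases hε with rfl | rfl <;> simp

lemma pseudo_mul_rev_of_pseudo_mul (hn : n % 4 = 2 ∨ n % 4 = 3) {M : Cl n} {ε : ℝ}
    (hε : ε = 1 ∨ ε = -1) (h : pseudo n * M = ε • (M * pseudo n)) :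
    pseudo n * rev M = ε • (rev M * pseudo n) := by
  have := congrArg rev h
  rw [rev_mul, rev_smul, rev_mul, rev_pseudo hn] at this
  simp only [mul_neg, neg_mul, smul_neg, neg_inj] at this
  rw [this, smul_smul]
  rcases hε with rfl | rfl <;> simp

/-- A measurable representative with the commutation relation at every point. -/
lemma exists_measurable_representative {Ψ : E n → Cl n} (hΨ : AEStronglyMeasurable Ψ) {ε : ℝ}
    (h : ∀ᵐ ω, pseudo n * Ψ ω = ε • (Ψ ω * pseudo n)) :
    ∃ Ψ' : E n → Cl n, Measurable Ψ' ∧ Ψ =ᵐ[volume] Ψ' ∧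
      ∀ ω, pseudo n * Ψ' ω = ε • (Ψ' ω * pseudo n) := by
  obtain ⟨Φ, hΦ, he⟩ := hΨ
  have hc : IsClosed {M : Cl n | pseudo n * M = ε • (M * pseudo n)} :=
    isClosed_eq (mulL (pseudo n)).continuous
      ((mulL.flip (pseudo n)).continuous.const_smul ε)
  have hs : MeasurableSet {ω | pseudo n * Φ ω = ε • (Φ ω * pseudo n)} :=
    hΦ.measurable hc.measurableSet
  -- Replacing $\Phi$ by $0$, which satisfies the relation, on the null set where it fails keeps
  -- measurability.
  refine ⟨{ω | pseudo n * Φ ω = ε • (Φ ω * pseudo n)}.indicator Φ,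
    hΦ.measurable.indicator hs, ?_, fun ω => ?_⟩
  · filter_upwards [he, h] with ω h1 h2
    rw [Set.indicator_of_mem (by rwa [Set.mem_ofPred_eq, ← h1]), h1]
  · by_cases hω : ω ∈ {ω | pseudo n * Φ ω = ε • (Φ ω * pseudo n)}
    · rw [Set.indicator_of_mem hω]; exact hω
    · simp [Set.indicator_of_notMem hω]

lemma IsL2CFT.congr {f F F' : E n → Cl n} (h : IsL2CFT f F) (hF : F =ᵐ[volume] F') :
    IsL2CFT f F' := by
  obtain ⟨u, u1, u2, u3, u4⟩ := h.exists_seq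
  refine ⟨h.memLp, h.memLp'.ae_eq hF, u, u1, u2, u3, u4.congr fun k => ?_⟩
  exact eLpNorm_congr_ae (hF.mono fun x hx => by simp [hx])

/-! ### The uncertainty principle for a measurable family -/

lemma ae_apply_ne_zero (k : Fin n) : ∀ᵐ x : E n, x k ≠ 0 := by
  let T : E n →ₗ[ℝ] ℝ := (EuclideanSpace.proj k : E n →L[ℝ] ℝ).toLinearMap
  have hT : LinearMap.ker T ≠ ⊤ := fun h => by
    have : EuclideanSpace.single k (1 : ℝ) ∈ LinearMap.ker T := h ▸ Submodule.mem_top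
    simp [T] at this
  have h := Measure.addHaar_submodule volume (LinearMap.ker T) hT
  rw [ae_iff]
  convert h using 2
  ext x
  simp [T]

section Family

variable {P : Type*} [MeasurableSpace P] {μ : Measure P} {H : P × E n → Cl n}

lemma measurable_cftI_family (hH : Measurable H) :
    Measurable fun q : P × E n => cftI (fun ω => H (q.1, ω)) q.2 := by
  have h : StronglyMeasurable fun z : (P × E n) × E n =>
      H (z.1.1, z.2) * expI (-inner ℝ z.1.2 z.2) := by
    refine Measurable.stronglyMeasurable (Measurable.mul ?_ ?_)
    · exact hH.comp (by fun_prop)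
    · exact continuous_expI.measurable.comp (by fun_prop)
  exact (h.integral_prod_right' (ν := (volume : Measure (E n)))).measurable

variable (hn : n % 4 = 2 ∨ n % 4 = 3) (hH : Measurable H)
    (hi : ∀ᵐ p ∂μ, Integrable fun ω => H (p, ω))
    (hZ : ∫⁻ q, ‖H q‖ₑ ^ 2 ∂μ.prod volume ≠ ⊤)
include hH hZ

lemma ae_memLp_family : ∀ᵐ p ∂μ, MemLp (fun ω => H (p, ω)) 2 := by
  rw [lintegral_prod _ (hH.enorm.pow_const 2).aemeasurable] at hZ
  filter_upwards [ae_lt_top (hH.enorm.pow_const 2).lintegral_prod_right' hZ] with p hp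
  refine ⟨(hH.comp measurable_prodMk_left).aestronglyMeasurable, ?_⟩
  rw [← eLpNorm_two_sq] at hp
  by_contra hc
  rw [not_lt, top_le_iff] at hc
  simp [hc] at hp

include hn hi

/-- Since $b_k\ne0$ almost everywhere, the transforms vanish almost everywhere, and Plancherel
carries this back to $H$. It disposes of the product $0\cdot\infty$. -/
lemma lintegral_family_eq_zero (k : Fin n)
    (h0 : ∫⁻ q : P × E n, ENNReal.ofReal (q.2 k ^ 2) * ‖cftI (fun ω => H (q.1, ω)) q.2‖ₑ ^ 2
      ∂μ.prod volume = 0) : ∫⁻ q, ‖H q‖ₑ ^ 2 ∂μ.prod volume = 0 := by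
  have hm : Measurable fun q : P × E n =>
      ENNReal.ofReal (q.2 k ^ 2) * ‖cftI (fun ω => H (q.1, ω)) q.2‖ₑ ^ 2 :=
    Measurable.mul (by fun_prop) ((measurable_cftI_family hH).enorm.pow_const 2)
  rw [lintegral_prod _ hm.aemeasurable, lintegral_eq_zero_iff hm.lintegral_prod_right'] at h0
  rw [lintegral_prod _ (hH.enorm.pow_const 2).aemeasurable,
    lintegral_eq_zero_iff (hH.enorm.pow_const 2).lintegral_prod_right']
  filter_upwards [h0, hi, ae_memLp_family hH hZ] with p hp hp1 hp2
  have hp' := (lintegral_eq_zero_iff (hm.comp measurable_prodMk_left)).1 hp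
  have hc : ∫⁻ b, ‖cftI (fun ω => H (p, ω)) b‖ₑ ^ 2 = 0 := by
    rw [lintegral_eq_zero_iff'
      ((continuous_cftI hn hp1).measurable.enorm.pow_const 2).aemeasurable]
    filter_upwards [hp', ae_apply_ne_zero k] with b hb hbk
    have : ENNReal.ofReal (b k ^ 2) ≠ 0 := by
      rw [Ne, ENNReal.ofReal_eq_zero, not_le]; positivity
    exact (mul_eq_zero.1 hb).resolve_left this
  rw [lintegral_cftI_sq hn hp1 hp2] at hc
  refine (mul_eq_zero.1 hc).resolve_left ?_
  rw [ENNReal.ofReal_eq_zero, not_le]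
  positivity

lemma lintegral_translate_family_le (k : Fin n) (t : ℝ) :
    ENNReal.ofReal ((2 * Real.pi) ^ n) *
        ∫⁻ q, ‖H (q.1, q.2 + t • EuclideanSpace.single k (1 : ℝ)) - H q‖ₑ ^ 2 ∂μ.prod volume ≤
      ENNReal.ofReal (t ^ 2) * ∫⁻ q : P × E n, ENNReal.ofReal (q.2 k ^ 2) *
        ‖cftI (fun ω => H (q.1, ω)) q.2‖ₑ ^ 2 ∂μ.prod volume := by
  have hm : Measurable fun q : P × E n =>
      ENNReal.ofReal (q.2 k ^ 2) * ‖cftI (fun ω => H (q.1, ω)) q.2‖ₑ ^ 2 :=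
    Measurable.mul (by fun_prop) ((measurable_cftI_family hH).enorm.pow_const 2)
  have hd : Measurable fun q : P × E n =>
      ‖H (q.1, q.2 + t • EuclideanSpace.single k (1 : ℝ)) - H q‖ₑ ^ 2 :=
    ((hH.comp (by fun_prop)).sub hH).enorm.pow_const 2
  rw [lintegral_prod _ hm.aemeasurable, lintegral_prod _ hd.aemeasurable,
    ← lintegral_const_mul' _ _ ENNReal.ofReal_ne_top,
    ← lintegral_const_mul' _ _ ENNReal.ofReal_ne_top]
  refine lintegral_mono_ae ?_
  filter_upwards [hi, ae_memLp_family hH hZ] with p hp1 hp2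
  exact lintegral_translate_sub_sq_le hn hp1 hp2 k t

variable [SFinite μ]

/-- The uncertainty inequality in one coordinate. -/
lemma uncertainty_family_coord (k : Fin n) :
    ENNReal.ofReal ((2 * Real.pi) ^ n) * (∫⁻ q, ‖H q‖ₑ ^ 2 ∂μ.prod volume) ^ 2 ≤
      4 * (∫⁻ q : P × E n, ENNReal.ofReal (q.2 k ^ 2) * ‖cftI (fun ω => H (q.1, ω)) q.2‖ₑ ^ 2
          ∂μ.prod volume) *
        ∫⁻ q : P × E n, ENNReal.ofReal (q.2 k ^ 2) * ‖H q‖ₑ ^ 2 ∂μ.prod volume := by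
  set X := ∫⁻ q : P × E n, ENNReal.ofReal (q.2 k ^ 2) * ‖cftI (fun ω => H (q.1, ω)) q.2‖ₑ ^ 2
    ∂μ.prod volume with hX
  set Y := ∫⁻ q : P × E n, ENNReal.ofReal (q.2 k ^ 2) * ‖H q‖ₑ ^ 2 ∂μ.prod volume with hY
  by_cases hX0 : X = 0
  · rw [lintegral_family_eq_zero hn hH hi hZ k hX0]; simp
  have hmY : Measurable fun q : P × E n => ENNReal.ofReal (q.2 k ^ 2) * ‖H q‖ₑ ^ 2 :=
    Measurable.mul (by fun_prop) (hH.enorm.pow_const 2)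
  by_cases hY0 : Y = 0
  · have : ∫⁻ q, ‖H q‖ₑ ^ 2 ∂μ.prod volume = 0 := by
      rw [hY, lintegral_eq_zero_iff hmY] at hY0
      rw [lintegral_eq_zero_iff (hH.enorm.pow_const 2)]
      have hk : ∀ᵐ q ∂μ.prod (volume : Measure (E n)), q.2 k ≠ 0 :=
        Measure.quasiMeasurePreserving_snd.ae (ae_apply_ne_zero k)
      filter_upwards [hY0, hk] with q h1 h2
      have : ENNReal.ofReal (q.2 k ^ 2) ≠ 0 := by
        rw [Ne, ENNReal.ofReal_eq_zero, not_le]; positivity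
      exact (mul_eq_zero.1 h1).resolve_left this
    rw [this]; simp
  by_cases hXt : X = ⊤
  · rw [hXt, ENNReal.mul_top (by simp), ENNReal.top_mul hY0]; exact le_top
  by_cases hYt : Y = ⊤
  · rw [hYt, ENNReal.mul_top (mul_ne_zero (by simp) hX0)]; exact le_top
  set c := ENNReal.ofReal ((2 * Real.pi) ^ n) with hc
  have hc0 : c ≠ 0 := by rw [hc, Ne, ENNReal.ofReal_eq_zero, not_le]; positivity
  have hct : c ≠ ⊤ := ENNReal.ofReal_ne_top
  have hmp : ∀ t : ℝ, MeasurePreserving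
      (fun q : P × E n => (q.1, q.2 + t • EuclideanSpace.single k (1 : ℝ)))
      (μ.prod volume) (μ.prod volume) := fun t =>
    (MeasurePreserving.id μ).prod (measurePreserving_add_right volume _)
  -- The squared Lipschitz constant of translation is $(2\pi)^{-n}X$, by Plancherel.
  have h := lintegral_sq_le_of_translation (K := c⁻¹ * X) hH.aestronglyMeasurable
    (ξ := fun q : P × E n => q.2 k) (by fun_prop) _ hmp (fun t q => by simp) hZ hYt
    (ENNReal.mul_ne_top (ENNReal.inv_ne_top.2 hc0) hXt) fun t _ => by
      have := lintegral_translate_family_le hn hH hi hZ k t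
      rw [mul_left_comm, ← ENNReal.div_eq_inv_mul, ENNReal.le_div_iff_mul_le (Or.inl hc0)
        (Or.inl hct), mul_comm]
      exact this
  calc c * (∫⁻ q, ‖H q‖ₑ ^ 2 ∂μ.prod volume) ^ 2 ≤ c * (4 * (c⁻¹ * X) * Y) := by gcongr
    _ = (c * c⁻¹) * (4 * X * Y) := by ring
    _ = 4 * X * Y := by rw [ENNReal.mul_inv_cancel hc0 hct, one_mul]

/-- The uncertainty principle for a measurable family of functions. -/
lemma uncertainty_family :
    (n : ℝ≥0∞) * (ENNReal.ofReal ((2 * Real.pi) ^ n) * (∫⁻ q, ‖H q‖ₑ ^ 2 ∂μ.prod volume) ^ 2) ≤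
      4 * (∫⁻ q, ‖q.2‖ₑ ^ 2 * ‖cftI (fun ω => H (q.1, ω)) q.2‖ₑ ^ 2 ∂μ.prod volume) *
        ∫⁻ q, ‖q.2‖ₑ ^ 2 * ‖H q‖ₑ ^ 2 ∂μ.prod volume := by
  have hsum : ∀ x : E n, ‖x‖ₑ ^ 2 = ∑ k, ENNReal.ofReal (x k ^ 2) := fun x => by
    rw [← ENNReal.ofReal_sum_of_nonneg fun _ _ => sq_nonneg _, ← ofReal_norm,
      ← ENNReal.ofReal_pow (norm_nonneg _), EuclideanSpace.norm_sq_eq]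
    simp
  have split : ∀ {N : P × E n → ℝ≥0∞}, Measurable N →
      ∫⁻ q, ‖q.2‖ₑ ^ 2 * N q ∂μ.prod volume =
        ∑ k, ∫⁻ q : P × E n, ENNReal.ofReal (q.2 k ^ 2) * N q ∂μ.prod volume := fun {N} hN => by
    have hk : ∀ k ∈ (Finset.univ : Finset (Fin n)),
        Measurable fun q : P × E n => ENNReal.ofReal (q.2 k ^ 2) * N q :=
      fun k _ => Measurable.mul (by fun_prop) hN
    rw [← lintegral_finsetSum _ hk]
    simp only [hsum, Finset.sum_mul]
  rw [split ((measurable_cftI_family hH).enorm.pow_const 2), split (hH.enorm.pow_const 2)]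
  set X : Fin n → ℝ≥0∞ := fun k => ∫⁻ q : P × E n, ENNReal.ofReal (q.2 k ^ 2) *
    ‖cftI (fun ω => H (q.1, ω)) q.2‖ₑ ^ 2 ∂μ.prod volume
  set Y : Fin n → ℝ≥0∞ := fun k => ∫⁻ q : P × E n, ENNReal.ofReal (q.2 k ^ 2) * ‖H q‖ₑ ^ 2 ∂μ.prod volume
  calc (n : ℝ≥0∞) * (ENNReal.ofReal ((2 * Real.pi) ^ n) * (∫⁻ q, ‖H q‖ₑ ^ 2 ∂μ.prod volume) ^ 2)
      = ∑ _k : Fin n, ENNReal.ofReal ((2 * Real.pi) ^ n) *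
          (∫⁻ q, ‖H q‖ₑ ^ 2 ∂μ.prod volume) ^ 2 := by simp
    _ ≤ ∑ k, 4 * X k * Y k :=
        Finset.sum_le_sum fun k _ => uncertainty_family_coord hn hH hi hZ k
    -- Enlarging each $Y_k$ to the full sum is crude, but it gives exactly the required factor $n$.
    _ ≤ ∑ k, 4 * X k * ∑ j, Y j := Finset.sum_le_sum fun k _ =>
        mul_le_mul_right (Finset.single_le_sum (fun _ _ => zero_le) (Finset.mem_univ k)) _
    _ = 4 * (∑ k, X k) * ∑ j, Y j := by rw [← Finset.sum_mul, ← Finset.mul_sum]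

end Family

/-! ### The wavelet transform on the Fourier side -/

/-- The Fourier transform in the translation variable of the wavelet transform. -/
def waveletSymbol (F Ψ : E n → Cl n) (q : (ℝ × SO n) × E n) : Cl n :=
  F q.2 * rev (q.1.1 ^ ((n : ℝ) / 2) • Ψ (q.1.1 • rot q.1.2⁻¹ q.2))

section Symbol

variable {F Ψ : E n → Cl n}

lemma measurable_waveletSymbol (hF : Measurable F) (hΨ : Measurable Ψ) :
    Measurable (waveletSymbol F Ψ) := by
  refine Measurable.mul (hF.comp measurable_snd) (continuous_rev.measurable.comp ?_)
  have h : Measurable fun q : (ℝ × SO n) × E n => q.1.1 ^ ((n : ℝ) / 2) := by fun_prop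
  exact h.smul (hΨ.comp measurable_dilRot)

lemma integrable_waveletSymbol (hF : MemLp F 2) (hΨ : MemLp Ψ 2) {p : ℝ × SO n} (hp : 0 < p.1) :
    Integrable fun ω => waveletSymbol F Ψ (p, ω) :=
  memLp_mul_integrable hF
    (memLp_rev ((memLp_comp_smul_rot hp p.2 hΨ).const_smul (p.1 ^ ((n : ℝ) / 2))))

lemma norm_waveletSymbol_sq {p : ℝ × SO n} (hp : 0 < p.1) (ω : E n) :
    ‖waveletSymbol F Ψ (p, ω)‖ ^ 2 = inner ℝ (F ω) (F ω *
      (p.1 ^ n • (rev (Ψ (p.1 • rot p.2⁻¹ ω)) * Ψ (p.1 • rot p.2⁻¹ ω)))) := by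
  have h1 : p.1 ^ n = p.1 ^ ((n : ℝ) / 2) * p.1 ^ ((n : ℝ) / 2) := by
    rw [← Real.rpow_add hp, add_halves, Real.rpow_natCast]
  rw [← real_inner_self_eq_norm_sq, waveletSymbol, inner_mul_right_eq, rev_rev, rev_smul, h1]
  congr 1
  simp only [mul_smul_comm, smul_mul_assoc, smul_smul, mul_assoc]

/-- $|H_p(\omega)|^2$ is the fixed linear form $M\mapsto\langle F(\omega),F(\omega)M\rangle$ applied
to the admissibility integrand, so integration over $p$ replaces $M$ by $C$. Nonnegativity comes
from integrating squares. -/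
lemma lintegral_waveletSymbol {ν : Measure (SO n)} {C : Cl n} {ω : E n}
    (h : Integrable (fun p : ℝ × SO n => p.1 ^ n • (rev (Ψ (p.1 • rot p.2⁻¹ ω)) *
      Ψ (p.1 • rot p.2⁻¹ ω))) (dilRotMeasure ν))
    (hC : ∫ p : ℝ × SO n, p.1 ^ n • (rev (Ψ (p.1 • rot p.2⁻¹ ω)) * Ψ (p.1 • rot p.2⁻¹ ω))
      ∂dilRotMeasure ν = C) :
    0 ≤ inner ℝ (F ω) (F ω * C) ∧ ∫⁻ p, ‖waveletSymbol F Ψ (p, ω)‖ₑ ^ 2 ∂dilRotMeasure ν =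
      ENNReal.ofReal (inner ℝ (F ω) (F ω * C)) := by
  let L : Cl n →L[ℝ] ℝ := (innerSL ℝ (F ω)).comp (mulL (F ω))
  have hL := L.integral_comp_comm h
  have hLi := L.integrable_comp h
  rw [hC] at hL
  have hpos := ae_dilRotMeasure_pos ν
  have hnn : 0 ≤ᵐ[dilRotMeasure ν] fun p => L (p.1 ^ n • (rev (Ψ (p.1 • rot p.2⁻¹ ω)) *
      Ψ (p.1 • rot p.2⁻¹ ω))) := by
    filter_upwards [hpos] with p hp
    exact (sq_nonneg _).trans_eq (norm_waveletSymbol_sq (F := F) (Ψ := Ψ) hp ω)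
  change 0 ≤ L C ∧ _ = ENNReal.ofReal (L C)
  rw [← hL]
  refine ⟨integral_nonneg_of_ae hnn, ?_⟩
  rw [ofReal_integral_eq_lintegral_ofReal hLi hnn]
  refine lintegral_congr_ae ?_
  filter_upwards [hpos] with p hp
  rw [← ofReal_norm, ← ENNReal.ofReal_pow (norm_nonneg _), norm_waveletSymbol_sq hp]
  rfl

/-- The commutation sign carries $e^{i_n\omega\cdot b}$ past $\widetilde\Psi$ as
$e^{i_n\varepsilon\,\omega\cdot b}$, which is the Fourier kernel at $-\varepsilon b$. -/
lemma cftI_waveletSymbol (hn : n % 4 = 2 ∨ n % 4 = 3) {f ψ : E n → Cl n} (hf : IsL2CFT f F)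
    (hψ : IsL2CFT ψ Ψ) {ε : ℝ} (hε : ε = 1 ∨ ε = -1)
    (hΨ : ∀ ω, pseudo n * Ψ ω = ε • (Ψ ω * pseudo n)) {p : ℝ × SO n} (hp : 0 < p.1) (b : E n) :
    cftI (fun ω => waveletSymbol F Ψ (p, ω)) (-ε • b) =
      (2 * Real.pi) ^ n • waveletTransform ψ f (p, b) := by
  have h := waveletTransform_eq hp p.2 b hn hf hψ
  rw [show ((p.1, p.2), b) = (p, b) from rfl] at h
  rw [h, cftI]
  refine integral_congr_ae (Eventually.of_forall fun ω => ?_)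
  have e := expI_mul_of_pseudo_mul hε
    (pseudo_mul_rev_of_pseudo_mul hn hε (hΨ (p.1 • rot p.2⁻¹ ω))) (inner ℝ ω b)
  simp only [waveletSymbol, rev_smul, mul_smul_comm, smul_mul_assoc, mul_assoc, e]
  congr 4
  rw [inner_smul_left, real_inner_comm]
  simp

end Symbol

/-- Cyclicity of the scalar part: $\langle C\widetilde GG\rangle=\langle GC\widetilde G\rangle$. -/
lemma scalarProd_innerCl_rev {X : Type*} [MeasurableSpace X] {μ : Measure X} {G : X → Cl n}
    (hG : MemLp G 2 μ) (C : Cl n) :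
    scalarProd C (innerCl μ (fun x => rev (G x)) (fun x => rev (G x))) =
      ∫ x, inner ℝ (G x) (G x * C) ∂μ := by
  rw [innerCl_eq (memLp_rev hG) (memLp_rev hG), scalarProd]
  have h := memLp_mul_integrable (memLp_rev hG) (memLp_rev (memLp_rev hG))
  change ScC (mulL C (∫ x, rev (G x) * rev (rev (G x)) ∂μ)) = _
  rw [← (mulL C).integral_comp_comm h, ← ScC.integral_comp_comm ((mulL C).integrable_comp h)]
  refine integral_congr_ae (Eventually.of_forall fun x => ?_)
  simp only [mulL_apply, ScC_apply, rev_rev]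
  rw [real_inner_comm, inner_eq, ← mul_assoc, Sc_mul_comm, mul_assoc]

lemma integrable_inner_mul {X : Type*} [MeasurableSpace X] {μ : Measure X} {G : X → Cl n}
    (hG : MemLp G 2 μ) (C : Cl n) : Integrable (fun x => inner ℝ (G x) (G x * C)) μ :=
  ScC.integrable_comp (memLp_mul_integrable hG (memLp_rev ((mulL.flip C).comp_memLp' hG)))

/-- Since $\omega^2=|\omega|^2$, there is equality when $\omega F\in L^2$; otherwise the right side
is $\infty$ by convention. -/
lemma lintegral_le_starSelf {F : E n → Cl n} {C : Cl n}
    (hq : ∀ᵐ ω, 0 ≤ inner ℝ (F ω) (F ω * C)) :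
    ∫⁻ ω, ‖ω‖ₑ ^ 2 * ENNReal.ofReal (inner ℝ (F ω) (F ω * C)) ≤
      starSelf volume C (fun ω => rev (vec ω * F ω)) := by
  unfold starSelf
  split_ifs with h
  · have hG : MemLp (fun ω => vec ω * F ω) 2 := by
      simpa using memLp_rev (isL2_iff.1 h)
    have e : ∀ ω, inner ℝ (vec ω * F ω) (vec ω * F ω * C) =
        ‖ω‖ ^ 2 * inner ℝ (F ω) (F ω * C) := fun ω => by
      rw [inner_mul_left_eq, rev_vec, mul_assoc, ← mul_assoc, vec_mul_self, smul_mul_assoc,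
        one_mul, real_inner_smul_right]
    have hi := integrable_inner_mul hG C
    simp only [e] at hi
    rw [scalarProd_innerCl_rev hG]
    simp only [e]
    rw [ofReal_integral_eq_lintegral_ofReal hi (hq.mono fun ω hω => by positivity)]
    refine le_of_eq (lintegral_congr fun ω => ?_)
    rw [ENNReal.ofReal_mul (by positivity), ENNReal.ofReal_pow (norm_nonneg _), ofReal_norm]
  · exact le_top

/-- The position factor in terms of the symbol. -/
lemma lintegral_cftI_waveletSymbol (hn : n % 4 = 2 ∨ n % 4 = 3) (ν : Measure (SO n))
    [SigmaFinite ν] {f ψ F Ψ : E n → Cl n} (hf : IsL2CFT f F) (hψ : IsL2CFT ψ Ψ)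
    (hFm : Measurable F) (hΨm : Measurable Ψ) {ε : ℝ} (hε : ε = 1 ∨ ε = -1)
    (hΨ : ∀ ω, pseudo n * Ψ ω = ε • (Ψ ω * pseudo n)) :
    ∫⁻ q, ‖q.2‖ₑ ^ 2 * ‖cftI (fun ω => waveletSymbol F Ψ (q.1, ω)) q.2‖ₑ ^ 2 ∂simMeasure ν =
      ENNReal.ofReal ((2 * Real.pi) ^ n) ^ 2 *
        normSqL2 (simMeasure ν) (fun g => vec g.2 * waveletTransform ψ f g) := by
  -- The sign in $-\varepsilon b$ is harmless because reflection preserves both the measure and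
  -- $|b|$.
  have hmp : MeasurePreserving (fun q : (ℝ × SO n) × E n => (q.1, -ε • q.2))
      (simMeasure ν) (simMeasure ν) := by
    have h : MeasurePreserving (fun x : E n => -ε • x) := by
      rcases hε with rfl | rfl
      · have e : (fun x : E n => -(1 : ℝ) • x) = Neg.neg := by ext1 x; simp
        rw [e]
        exact Measure.measurePreserving_neg _
      · have e : (fun x : E n => -(-1 : ℝ) • x) = id := by ext1 x; simp
        rw [e]
        exact MeasurePreserving.id _
    exact (MeasurePreserving.id (dilRotMeasure ν)).prod h
  have hm : Measurable fun q : (ℝ × SO n) × E n =>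
      ‖q.2‖ₑ ^ 2 * ‖cftI (fun ω => waveletSymbol F Ψ (q.1, ω)) q.2‖ₑ ^ 2 :=
    Measurable.mul (by fun_prop)
      ((measurable_cftI_family (measurable_waveletSymbol hFm hΨm)).enorm.pow_const 2)
  rw [← hmp.lintegral_comp hm, normSqL2_eq,
    ← lintegral_const_mul' _ _ (ENNReal.pow_ne_top ENNReal.ofReal_ne_top)]
  have hpos : ∀ᵐ q ∂simMeasure ν, 0 < q.1.1 :=
    Measure.quasiMeasurePreserving_fst.ae (ae_dilRotMeasure_pos ν)
  refine lintegral_congr_ae (hpos.mono fun q hq => ?_)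
  have h1 : ‖-ε • q.2‖ₑ = ‖q.2‖ₑ := by
    rcases hε with rfl | rfl <;> simp
  dsimp only
  rw [cftI_waveletSymbol hn hf hψ hε hΨ hq, h1, enorm_smul, ← ofReal_norm (vec q.2 * _),
    norm_vec_mul, ENNReal.ofReal_mul (norm_nonneg _), ofReal_norm, ofReal_norm,
    Real.enorm_of_nonneg (by positivity)]
  ring

/-- The admissibility constant commutes with the pseudoscalar. -/
lemma integral_mul_pseudo {X : Type*} [MeasurableSpace X] {μ : Measure X}
    (hn : n % 4 = 2 ∨ n % 4 = 3) {Ψ : X → Cl n} {ρ : X → ℝ} {ε : ℝ} (hε : ε = 1 ∨ ε = -1)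
    (hΨ : ∀ x, pseudo n * Ψ x = ε • (Ψ x * pseudo n))
    (hi : Integrable (fun x => ρ x • (rev (Ψ x) * Ψ x)) μ) :
    (∫ x, ρ x • (rev (Ψ x) * Ψ x) ∂μ) * pseudo n =
      pseudo n * ∫ x, ρ x • (rev (Ψ x) * Ψ x) ∂μ := by
  change mulL.flip (pseudo n) (∫ x, ρ x • (rev (Ψ x) * Ψ x) ∂μ) =
    mulL (pseudo n) (∫ x, ρ x • (rev (Ψ x) * Ψ x) ∂μ)
  rw [← ContinuousLinearMap.integral_comp_comm _ hi, ← ContinuousLinearMap.integral_comp_comm _ hi]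
  refine integral_congr_ae (Eventually.of_forall fun x => ?_)
  have h1 := hΨ x
  have h2 := pseudo_mul_rev_of_pseudo_mul hn hε h1
  simp only [ContinuousLinearMap.flip_apply, mulL_apply, smul_mul_assoc, mul_smul_comm]
  congr 1
  rw [← mul_assoc, h2, smul_mul_assoc, mul_assoc (rev (Ψ x)) (pseudo n), h1, mul_smul_comm,
    smul_smul, mul_assoc]
  rcases hε with rfl | rfl <;> simp

end CliffordWavelet

end

/-! ### The uncertainty principle -/

open CliffordWavelet in
theorem mainTheorem3 (n : ℕ) (hn : n % 4 = 2 ∨ n % 4 = 3)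
    (ν : Measure (SO n)) [ν.IsHaarMeasure]
    (ψ : E n → Cl n) (C : Cl n) (hψ : IsAdmissible ν ψ C)
    (hpar : n % 4 = 2 → HasParity ψ)
    (f : E n → Cl n) (hf : IsL2 f volume) :
    ENNReal.ofReal ((n : ℝ) * (2 * Real.pi) ^ n / 4 *
        (scalarProd C (innerCl volume (fun x => rev (f x)) (fun x => rev (f x)))) ^ 2) ≤
      normSqL2 (simMeasure ν) (fun g => vec g.2 * waveletTransform ψ f g) *
        starSelf volume C (fun ω => rev (vec ω * cft f ω)) := by
  obtain ⟨hψ2, -, hadm⟩ := hψ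
  have hF0 := isL2CFT_cft hn (isL2_iff.1 hf)
  have hΨ0 := isL2CFT_cft hn (isL2_iff.1 hψ2)
  obtain ⟨ε, hε, hpar0⟩ := exists_parity_sign hn hΨ0 hpar
  obtain ⟨Ψ, hΨm, hΨae, hΨpar⟩ := exists_measurable_representative hΨ0.memLp'.1 hpar0
  obtain ⟨F, hFm, hFae⟩ : ∃ F, Measurable F ∧ cft f =ᵐ[volume] F := by
    obtain ⟨F, hF, he⟩ := hF0.memLp'.1
    exact ⟨F, hF.measurable, he⟩
  have hF := hF0.congr hFae
  have hΨ := hΨ0.congr hΨae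
  have hadm' : ∀ᵐ ω : E n, Integrable (fun p : ℝ × SO n => p.1 ^ n •
      (rev (Ψ (p.1 • rot p.2⁻¹ ω)) * Ψ (p.1 • rot p.2⁻¹ ω))) (dilRotMeasure ν) ∧
      ∫ p : ℝ × SO n, p.1 ^ n • (rev (Ψ (p.1 • rot p.2⁻¹ ω)) * Ψ (p.1 • rot p.2⁻¹ ω))
        ∂dilRotMeasure ν = C := by
    filter_upwards [hadm, ae_ae_dilRot ν hΨae] with ω h1 h2
    have e : admIntegrand ψ ω =ᵐ[dilRotMeasure ν] fun p : ℝ × SO n => p.1 ^ n •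
        (rev (Ψ (p.1 • rot p.2⁻¹ ω)) * Ψ (p.1 • rot p.2⁻¹ ω)) :=
      h2.mono fun p hp => by simp only [admIntegrand, hp]
    have hi := clIntegrable_iff.1 h1.1
    refine ⟨hi.congr e, ?_⟩
    rw [← integral_congr_ae e, ← clIntegral_eq hi, h1.2]
  -- $\Psi$ and $\widetilde\Psi$ each contribute the sign $\varepsilon$, and $\varepsilon^2=1$.
  have hCcomm : C * pseudo n = pseudo n * C := by
    obtain ⟨ω, h1, h2⟩ := hadm'.exists
    rw [← h2]
    exact integral_mul_pseudo hn hε (fun p => hΨpar _) h1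
  have hq : ∀ᵐ ω, 0 ≤ inner ℝ (F ω) (F ω * C) :=
    hadm'.mono fun ω h => (lintegral_waveletSymbol h.1 h.2).1
  set S := scalarProd C (innerCl volume (fun x => rev (f x)) (fun x => rev (f x))) with hS
  -- Because $C$ commutes with $i_n$, the transform of $fC$ is $FC$, and polarized Plancherel
  -- applies.
  have hint : ∫ ω, inner ℝ (F ω) (F ω * C) = (2 * Real.pi) ^ n * S := by
    rw [hS, scalarProd_innerCl_rev hF.memLp]
    refine hF.integral_inner hn (hF.clm hn (mulL.flip C) fun M t => ?_)
    simp only [ContinuousLinearMap.flip_apply, mulL_apply, expI, mul_add, add_mul,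
      mul_smul_comm, smul_mul_assoc, mul_one, mul_assoc, hCcomm]
  have hπ : (0 : ℝ) < (2 * Real.pi) ^ n := by positivity
  have hS0 : 0 ≤ S := by
    have : 0 ≤ (2 * Real.pi) ^ n * S := hint ▸ integral_nonneg_of_ae hq
    exact nonneg_of_mul_nonneg_right this hπ
  have hHm := measurable_waveletSymbol hFm hΨm
  set c := ENNReal.ofReal ((2 * Real.pi) ^ n) with hc
  -- By Tonelli, integrate over $p$ first, where admissibility evaluates the inner integral.
  have hZ : ∫⁻ q, ‖waveletSymbol F Ψ q‖ₑ ^ 2 ∂(dilRotMeasure ν).prod volume =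
      c * ENNReal.ofReal S := by
    rw [lintegral_prod_symm' _ (hHm.enorm.pow_const 2), hc, ← ENNReal.ofReal_mul hπ.le, ← hint,
      ofReal_integral_eq_lintegral_ofReal (integrable_inner_mul hF.memLp' C) hq]
    exact lintegral_congr_ae (hadm'.mono fun ω h => (lintegral_waveletSymbol h.1 h.2).2)
  have hY : ∫⁻ q, ‖q.2‖ₑ ^ 2 * ‖waveletSymbol F Ψ q‖ₑ ^ 2 ∂(dilRotMeasure ν).prod volume ≤
      starSelf volume C (fun ω => rev (vec ω * cft f ω)) := by
    have hm : Measurable fun q : (ℝ × SO n) × E n => ‖q.2‖ₑ ^ 2 * ‖waveletSymbol F Ψ q‖ₑ ^ 2 :=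
      Measurable.mul (by fun_prop) (hHm.enorm.pow_const 2)
    rw [lintegral_prod_symm' _ hm]
    refine le_trans (le_of_eq ?_) (lintegral_le_starSelf (F := cft f) (C := C) ?_)
    · refine lintegral_congr_ae ?_
      filter_upwards [hadm', hFae] with ω h h'
      rw [lintegral_const_mul' _ _ (by simp), (lintegral_waveletSymbol h.1 h.2).2, h']
    · filter_upwards [hq, hFae] with ω h h'
      rwa [h']
  have main := uncertainty_family (μ := dilRotMeasure ν) hn hHm
    ((ae_dilRotMeasure_pos ν).mono fun p hp => integrable_waveletSymbol hF.memLp' hΨ.memLp' hp)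
    (by rw [hZ]; exact ENNReal.mul_ne_top ENNReal.ofReal_ne_top ENNReal.ofReal_ne_top)
  have hX := lintegral_cftI_waveletSymbol hn ν hF hΨ hFm hΨm hε hΨpar
  rw [simMeasure] at hX
  rw [hX, hZ, ← hc] at main
  have hc0 : c ^ 2 * 4 ≠ 0 := mul_ne_zero (pow_ne_zero 2 (by simpa [hc] using hπ)) (by simp)
  have hct : c ^ 2 * 4 ≠ ⊤ :=
    ENNReal.mul_ne_top (ENNReal.pow_ne_top ENNReal.ofReal_ne_top) (by simp)
  -- The position factor of the symbol is $(2\pi)^{2n}$ times that of $T_\psi f$; together with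
  -- Heisenberg's 4 this is the finite nonzero factor $4c^2$.
  rw [← ENNReal.mul_le_mul_iff_right hc0 hct]
  have h4 : (4 : ℝ≥0∞) * ENNReal.ofReal (n * (2 * Real.pi) ^ n / 4 * S ^ 2) =
      n * c * ENNReal.ofReal S ^ 2 := by
    rw [hc, ← ENNReal.ofReal_pow hS0, ← ENNReal.ofReal_natCast,
      show (4 : ℝ≥0∞) = ENNReal.ofReal 4 by simp,
      ← ENNReal.ofReal_mul (by positivity), ← ENNReal.ofReal_mul (by positivity),
      ← ENNReal.ofReal_mul (by positivity)]
    congr 1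
    ring
  calc c ^ 2 * 4 * ENNReal.ofReal (n * (2 * Real.pi) ^ n / 4 * S ^ 2)
      = (n : ℝ≥0∞) * (c * (c * ENNReal.ofReal S) ^ 2) := by rw [mul_assoc, h4]; ring
    _ ≤ _ := main
    _ ≤ 4 * (c ^ 2 * normSqL2 (simMeasure ν) fun g => vec g.2 * waveletTransform ψ f g) *
        starSelf volume C (fun ω => rev (vec ω * cft f ω)) := by
      rw [simMeasure]; gcongr
    _ = _ := by ring
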